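/- **Setting.** Let $1\le T\in\mathbb N$, let $B(0)=1$, $B(1),\dots,B(T)>0$ be a deterministic bank account and $D(t)=B(t)^{-1}$. A *model* is a finite probability space with a filtration $(\mathcal F_t)_{0\le t\le T}$ and adapted processes $\underline S,S^C,\overline S$ (bid, reference and ask price of the underlying) with $0<\underline S_t\le S^C_t\le\overline S_t$ a.s. for $0\le t\le T$. Let $\epsilon\ge 0$. A call option is cash-settled against $S^C$; the option with maturity $t$ and discounted strike $k$ pays $(S^C_t-B(t)k)^+$ at time $t$. Given bid and ask prices at time $0$ of the underlying and of call options, a model is *$\epsilon$-consistent* with them if $\underline S_0,\overline S_0$ are a.s. equal to the given initial bid and ask price; $\mathbb E[(D(t)S^C_t-k)^+]$ lies between the given bid and ask price for every traded option (maturity $1\le t\le T$, discounted strike $k$); there is a process $S^*$ with $\underline S_t\le S^*_t\le\overline S_t$ a.s. for $0\le t\le T$ such that $(D(t)S^*_t)_{0\le t\le T}$ is a martingale; and $\overline S_t-\underline S_t\le\epsilon B(t)$, $S^C_t\ge\epsilon B(t)$ a.s. for all $0\le t\le T$. **Assumptions.** For every maturity $1\le t\le T$, options with all discounted strikes $k\in\mathbb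 R$ are traded, with equal bid and ask price $R_t(k)$; $R_t(k)=\int (y-k)^+\,\mu_t(dy)$ for a probability measure $\mu_t$ with finite support contained in $[\epsilon,\infty)$; the initial bid and ask price of the underlying are both equal to $S_0>0$, where $S_0\ge\epsilon$; and $\int y\,\mu_t(dy)\in[S_0-\epsilon,S_0+\epsilon]$. **Conditions.** For all $u\in\{2,\dots,T\}$ and all real $k_1,\dots,k_{u-1}$, writing $$\Sigma(\sigma_1,\sigma_u)=\sum_{t=1}^{u-1}\Bigl(R_{t+1}(k_t+\epsilon\sigma_{t+1})-R_t(k_t+\epsilon\sigma_t)\Bigr),\qquad \sigma_t=\operatorname{sgn}(k_{t-1}-k_t)\ \ (2\le t\le u-1),$$ the following hold: 1. $\Sigma(-1,1)+R_1(\epsilon)-R_u(\epsilon)+2\epsilon\ge 0$; 2. $\Sigma(-1,-1)+R_1(\epsilon)-S_0+2\epsilon\ge 0$; 3. $\Sigma(1,1)+S_0-R_u(\epsilon)\ge 0$; 4. $\Sigma(1,-1)\ge 0$. **Theorem.** Under these assumptions: (a) If an $\epsilon$-consistent model exists, then the conditions 1–4 hold. (b) If $\mu_t(\{\epsilon\})=0$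 for all $1\le t\le T$, then an $\epsilon$-consistent model exists if and only if the conditions 1–4 hold. (c) Without the restriction in (b), an $\epsilon$-consistent model in which the bid price is only required to satisfy $\underline S_t\ge 0$ instead of $\underline S_t>0$ exists if and only if the conditions 1–4 hold. -/

import Mathlib

open MeasureTheory ProbabilityTheory

noncomputable section

/-- Market data at time `0`: a deterministic bank account `B(0), …, B(T)`, the call options
traded for each maturity `1 ≤ t ≤ T` with their bid and ask prices, and the bid and ask prices of
the underlying. Options are indexed by the discounted strike `k`, i.e. the option with maturity `t`
and discounted strike `k` has strike `B(t) k`. Values at indices outside `0, …, T`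
(resp. `1, …, T` for options) are never used. -/
structure MarketData where
  /-- the time horizon -/
  T : ℕ
  one_le_T : 1 ≤ T
  /-- the bank account -/
  B : ℕ → ℝ
  B_pos : ∀ t ≤ T, 0 < B t
  B_zero : B 0 = 1
  /-- the discounted strikes of the traded options with maturity `t` -/
  strikes : ℕ → Set ℝ
  /-- bid prices of the options -/
  optBid : ℕ → ℝ → ℝ
  /-- ask prices of the options -/
  optAsk : ℕ → ℝ → ℝ
  /-- current bid price of the underlying -/
  bid₀ : ℝ
  /-- current ask price of the underlying -/
  ask₀ : ℝ
  bid₀_pos : 0 < bid₀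
  bid₀_le_ask₀ : bid₀ ≤ ask₀

/-- A finite filtered probability space with time set `{0, …, T}` and adapted processes
`bid ≤ ref ≤ ask` (bid price, reference price and ask price of the underlying), where the
bid price is nonnegative. Strict positivity of the bid price is the separate predicate
`BidAskModel.Positive`. -/
structure BidAskModel (T : ℕ) where
  Ω : Type
  finite : Finite Ω
  mΩ : MeasurableSpace Ω
  P : @Measure Ω mΩ
  isProb : @IsProbabilityMeasure Ω mΩ P
  ℱ : @Filtration Ω (Fin (T + 1)) _ mΩ
  bid : Fin (T + 1) → Ω → ℝ
  ref : Fin (T + 1) → Ω → ℝ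
  ask : Fin (T + 1) → Ω → ℝ
  adapted_bid : StronglyAdapted ℱ bid
  adapted_ref : StronglyAdapted ℱ ref
  adapted_ask : StronglyAdapted ℱ ask
  bid_nonneg : ∀ t, ∀ᵐ ω ∂P, 0 ≤ bid t ω
  bid_le_ref : ∀ t, ∀ᵐ ω ∂P, bid t ω ≤ ref t ω
  ref_le_ask : ∀ t, ∀ᵐ ω ∂P, ref t ω ≤ ask t ω

namespace BidAskModel

/-- The bid price process is strictly positive. -/
def Positive {T : ℕ} (M : BidAskModel T) : Prop :=
  ∀ t, ∀ᵐ ω ∂M.P, 0 < M.bid t ω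

/-- The model reproduces the given prices and admits a consistent price system `Sstar`
for the underlying. -/
structure IsConsistent (D : MarketData) (M : BidAskModel D.T) : Prop where
  bid_zero : ∀ᵐ ω ∂M.P, M.bid 0 ω = D.bid₀
  ask_zero : ∀ᵐ ω ∂M.P, M.ask 0 ω = D.ask₀
  option_price : ∀ t : Fin (D.T + 1), 1 ≤ (t : ℕ) → ∀ k ∈ D.strikes t,
    (∫ ω, max ((D.B t)⁻¹ * M.ref t ω - k) 0 ∂M.P) ∈ Set.Icc (D.optBid t k) (D.optAsk t k)
  exists_price_system : ∃ Sstar : Fin (D.T + 1) → M.Ω → ℝ,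
    (∀ t : Fin (D.T + 1), ∀ᵐ ω ∂M.P, M.bid t ω ≤ Sstar t ω ∧ Sstar t ω ≤ M.ask t ω) ∧
    Martingale (fun (t : Fin (D.T + 1)) ω => (D.B t)⁻¹ * Sstar t ω) M.ℱ M.P

/-- The model is consistent, its discounted bid-ask spread is bounded by `ε`, and its
discounted reference price is bounded below by `ε`. -/
structure IsEpsConsistent (D : MarketData) (ε : ℝ) (M : BidAskModel D.T) : Prop where
  consistent : M.IsConsistent D
  spread_le : ∀ t : Fin (D.T + 1), ∀ᵐ ω ∂M.P, M.ask t ω - M.bid t ω ≤ ε * D.B t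
  le_ref : ∀ t : Fin (D.T + 1), ∀ᵐ ω ∂M.P, ε * D.B t ≤ M.ref t ω

end BidAskModel

/-- The prices are `ε`-consistent with the absence of arbitrage: there is an `ε`-consistent model
(with strictly positive bid prices). -/
def EpsConsistent (D : MarketData) (ε : ℝ) : Prop :=
  ∃ M : BidAskModel D.T, M.Positive ∧ M.IsEpsConsistent D ε

/-- The same notion, except that the bid price of the underlying is allowed to vanish. -/
def EpsConsistentNonneg (D : MarketData) (ε : ℝ) : Prop :=
  ∃ M : BidAskModel D.T, M.IsEpsConsistent D ε

/-- The call function `x ↦ ∫ (y - x)⁺ μ(dy)` of a measure on the real line. -/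
def callFunction (μ : Measure ℝ) (x : ℝ) : ℝ :=
  ∫ y, max (y - x) 0 ∂μ

/-- For all maturities `1 ≤ t ≤ T`, all strikes are traded, bid and ask price of the option with
discounted strike `k` agree with `R t k`, and `R t` is the call function of a probability
measure `μ t` with finite support contained in `[ε, ∞)`. The initial bid and ask price of the
underlying are both `S₀`, and the mean of each `μ t` lies in `[S₀ - ε, S₀ + ε]`. -/
structure SimplifyingAssumptions (D : MarketData) (ε S₀ : ℝ) (R : ℕ → ℝ → ℝ)
    (μ : ℕ → Measure ℝ) : Prop where
  strikes_eq : ∀ t, 1 ≤ t → t ≤ D.T → D.strikes t = Set.univ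
  optBid_eq : ∀ t, 1 ≤ t → t ≤ D.T → ∀ k, D.optBid t k = R t k
  optAsk_eq : ∀ t, 1 ≤ t → t ≤ D.T → ∀ k, D.optAsk t k = R t k
  isProb : ∀ t, 1 ≤ t → t ≤ D.T → IsProbabilityMeasure (μ t)
  finite_support : ∀ t, 1 ≤ t → t ≤ D.T →
    ∃ F : Finset ℝ, (∀ x ∈ F, ε ≤ x) ∧ μ t ((F : Set ℝ)ᶜ) = 0
  R_eq : ∀ t, 1 ≤ t → t ≤ D.T → R t = callFunction (μ t)
  bid₀_eq : D.bid₀ = S₀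
  ask₀_eq : D.ask₀ = S₀
  mean_mem : ∀ t, 1 ≤ t → t ≤ D.T → (∫ y, y ∂μ t) ∈ Set.Icc (S₀ - ε) (S₀ + ε)

/-- The signs `σ_1, …, σ_u`: `σ_1 = s₁` and `σ_u = sᵤ` are prescribed, and
`σ_t = sgn (k_{t-1} - k_t)` for `2 ≤ t ≤ u - 1`. -/
def pathSign (k : ℕ → ℝ) (u : ℕ) (s₁ sᵤ : ℝ) (t : ℕ) : ℝ :=
  if t = 1 then s₁ else if t = u then sᵤ else Real.sign (k (t - 1) - k t)

/-- `∑_{t=1}^{u-1} (R_{t+1}(k_t + ε σ_{t+1}) - R_t(k_t + ε σ_t))` with `σ_1 = s₁`, `σ_u = sᵤ`. -/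
def pathSum (R : ℕ → ℝ → ℝ) (ε : ℝ) (k : ℕ → ℝ) (u : ℕ) (s₁ sᵤ : ℝ) : ℝ :=
  ∑ t ∈ Finset.Icc 1 (u - 1),
    (R (t + 1) (k t + ε * pathSign k u s₁ sᵤ (t + 1)) - R t (k t + ε * pathSign k u s₁ sᵤ t))

/-- The four families of inequalities, for all `u ∈ {2, …, T}` and all real `k_1, …, k_{u-1}`
(the other values of `k` are not used). -/
def PathConditions (T : ℕ) (R : ℕ → ℝ → ℝ) (ε S₀ : ℝ) : Prop :=
  ∀ u : ℕ, 2 ≤ u → u ≤ T → ∀ k : ℕ → ℝ,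
    0 ≤ pathSum R ε k u (-1) 1 + R 1 ε - R u ε + 2 * ε ∧
    0 ≤ pathSum R ε k u (-1) (-1) + R 1 ε - S₀ + 2 * ε ∧
    0 ≤ pathSum R ε k u 1 1 + S₀ - R u ε ∧
    0 ≤ pathSum R ε k u 1 (-1)

end

open MeasureTheory ProbabilityTheory

/-! Let X be the discounted reference price and Y the discounted price system of a model. Then |X_t
- Y_t| ≤ ε, X_t ≥ ε, E(X_t - k)⁺ = R_t(k), and Y is a martingale with mean S₀. Both directions work
with the call functions C_t(k) = E(Y_t - k)⁺.

Necessity. Closeness of X_t and Y_t bounds the increments and values of C_t by those of R_t with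
strikes shifted by ±ε, and C_t increases with t by Jensen. Summing C_{t+1}(k_t) - C_t(k_t) ≥ 0 over
t, regrouping by maturity and inserting these bounds gives the conditions
(`pathConditions_of_increasing`). The sign σ_t records the direction of the increment of C_t. The
four cases arise from two lower bounds for C_1 and two upper bounds for C_u.

Sufficiency. A convex function with the right boundary behaviour is the call function of a law
within ε of μ_t as soon as its increments obey the same bounds, that is, it is nonexpansive for the
asymmetric distance `callDist`; the quantile coupling then moves mass by at most ε
(`exists_joint_law`). The candidates `minCall` are minimal: start from the lowest admissible C_1 and
pass at each maturity to the smallest nonexpansive majorant. Unrolling the suprema produces a path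
of strikes, along which conditions 1–4 say exactly that the candidate stays below `upperCall`
(`minCall_le_upperCall`). This pins down mean and total mass, while convexity survives the recursion
(`minCall_chord`). The resulting laws increase in convex order, so Strassen's theorem
(`exists_martingale_coupling`) and gluing of transition kernels (`exists_martingale_paths`) give a
martingale. The minimum and maximum of reference price and price system serve as bid and ask
(`exists_model`). -/

/-! ### Path sums and their regrouping by maturity -/

theorem sum_Icc_shift (a b : ℕ → ℝ) (n : ℕ) :
    ∑ t ∈ Finset.Icc 1 (n + 1), (a (t + 1) - b t) =
      a (n + 2) - b 1 + ∑ t ∈ Finset.Icc 2 (n + 1), (a t - b t) := by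
  induction n with
  | zero => simp
  | succ n ih =>
    rw [Finset.sum_Icc_succ_top (by omega), ih,
      Finset.sum_Icc_succ_top (b := n + 1) (show 2 ≤ n + 1 + 1 by omega)]
    ring

theorem pathSum_eq (R : ℕ → ℝ → ℝ) (ε : ℝ) (k : ℕ → ℝ) (n : ℕ) (s₁ sᵤ : ℝ) :
    pathSum R ε k (n + 2) s₁ sᵤ = R (n + 2) (k (n + 1) + ε * sᵤ) - R 1 (k 1 + ε * s₁) +
      ∑ t ∈ Finset.Icc 2 (n + 1), (R t (k (t - 1) + ε * Real.sign (k (t - 1) - k t)) -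
        R t (k t + ε * Real.sign (k (t - 1) - k t))) := by
  have h := sum_Icc_shift (fun t => R t (k (t - 1) + ε * pathSign k (n + 2) s₁ sᵤ t))
    (fun t => R t (k t + ε * pathSign k (n + 2) s₁ sᵤ t)) n
  have h1 : pathSign k (n + 2) s₁ sᵤ 1 = s₁ := by simp [pathSign]
  have h2 : pathSign k (n + 2) s₁ sᵤ (n + 2) = sᵤ := by simp [pathSign]
  unfold pathSum
  simp only [Nat.add_sub_cancel, h1, h2] at h ⊢
  rw [show n + 2 - 1 = n + 1 from rfl] at h ⊢
  rw [h]
  congr 1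
  refine Finset.sum_congr rfl fun t ht => ?_
  rw [Finset.mem_Icc] at ht
  have : pathSign k (n + 2) s₁ sᵤ t = Real.sign (k (t - 1) - k t) := by
    rw [pathSign, if_neg (by omega), if_neg (by omega)]
  rw [this]

/-- The payoff of a call spread, long strike a and short strike b, increases with the underlying.
This single fact yields the increment bounds in both directions. -/
theorem call_diff_antitone {a b z w : ℝ} (hab : a ≤ b) (hzw : z ≤ w) :
    max (w - b) 0 - max (w - a) 0 ≤ max (z - b) 0 - max (z - a) 0 := by
  rcases max_cases (w - b) 0 with h1 | h1 <;> rcases max_cases (w - a) 0 with h2 | h2 <;>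
  rcases max_cases (z - b) 0 with h3 | h3 <;> rcases max_cases (z - a) 0 with h4 | h4 <;>
  linarith

/-- Isolates what necessity uses about the call functions of the price system. The inner maturities
use `h₁` or `h₂` according to σ_t. At the ends, σ_1 = 1 uses `h₃` and σ_1 = -1 uses `h₆`, while σ_u
= -1 uses `h₄` and σ_u = 1 uses `h₅`. -/
theorem pathConditions_of_increasing {T : ℕ} {R C : ℕ → ℝ → ℝ} {ε S₀ : ℝ}
    (h₁ : ∀ t, 1 ≤ t → t ≤ T → ∀ a b, a ≤ b → C t b - C t a ≤ R t (b + ε) - R t (a + ε))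
    (h₂ : ∀ t, 1 ≤ t → t ≤ T → ∀ a b, a ≤ b → C t a - C t b ≤ R t (a - ε) - R t (b - ε))
    (h₃ : ∀ t, 1 ≤ t → t ≤ T → ∀ k, R t (k + ε) ≤ C t k)
    (h₄ : ∀ t, 1 ≤ t → t ≤ T → ∀ k, C t k ≤ R t (k - ε))
    (h₅ : ∀ t, 1 ≤ t → t ≤ T → ∀ k, C t k ≤ S₀ + R t (k + ε) - R t ε)
    (h₆ : ∀ t, 1 ≤ t → t ≤ T → ∀ k, S₀ - 2 * ε - R t ε + R t (k - ε) ≤ C t k)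
    (hmono : ∀ t, 1 ≤ t → t + 1 ≤ T → ∀ k, C t k ≤ C (t + 1) k) :
    PathConditions T R ε S₀ := by
  intro u hu huT k
  obtain ⟨n, rfl⟩ := Nat.exists_eq_add_of_le' hu
  have hs := sum_Icc_shift (fun t => C t (k (t - 1))) (fun t => C t (k t)) n
  have hpos : 0 ≤ ∑ t ∈ Finset.Icc 1 (n + 1), (C (t + 1) (k (t + 1 - 1)) - C t (k t)) := by
    refine Finset.sum_nonneg fun t ht => ?_
    rw [Finset.mem_Icc] at ht
    simpa using hmono t ht.1 (by omega) (k t)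
  have hle : ∑ t ∈ Finset.Icc 2 (n + 1), (C t (k (t - 1)) - C t (k t)) ≤
      ∑ t ∈ Finset.Icc 2 (n + 1), (R t (k (t - 1) + ε * Real.sign (k (t - 1) - k t)) -
        R t (k t + ε * Real.sign (k (t - 1) - k t))) := by
    refine Finset.sum_le_sum fun t ht => ?_
    rw [Finset.mem_Icc] at ht
    rcases lt_trichotomy (k (t - 1)) (k t) with h | h | h
    · rw [Real.sign_of_neg (by linarith)]
      simpa [sub_eq_add_neg] using h₂ t (by omega) (by omega) _ _ h.le
    · rw [h]; simp
    · rw [Real.sign_of_pos (by linarith)]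
      simpa using h₁ t (by omega) (by omega) _ _ h.le
  simp only [pathSum_eq]
  rw [hs] at hpos
  simp only [show n + 2 - 1 = n + 1 from rfl] at hpos
  have a₁ := h₃ 1 le_rfl (by omega) (k 1)
  have a₂ := h₆ 1 le_rfl (by omega) (k 1)
  have b₁ := h₄ (n + 2) (by omega) huT (k (n + 1))
  have b₂ := h₅ (n + 2) (by omega) huT (k (n + 1))
  simp only [mul_neg, mul_one, ← sub_eq_add_neg]
  refine ⟨?_, ?_, ?_, ?_⟩ <;> linarith

/-! ### Necessity: call prices of two variables at distance at most ε -/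

section CallBounds

variable {Ω : Type*} {m : MeasurableSpace Ω} {P : Measure Ω} [IsProbabilityMeasure P]
  {X Y : Ω → ℝ} {ε : ℝ}

theorem integrable_call (hX : Integrable X P) (k : ℝ) :
    Integrable (fun ω => max (X ω - k) 0) P :=
  (hX.sub (integrable_const k)).sup (integrable_const 0)

theorem call_sub_le_call_sub (hX : Integrable X P) (hY : Integrable Y P)
    (h : ∀ᵐ ω ∂P, |X ω - Y ω| ≤ ε) {a b : ℝ} (hab : a ≤ b) :
    (∫ ω, max (Y ω - b) 0 ∂P) - ∫ ω, max (Y ω - a) 0 ∂P ≤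
      (∫ ω, max (X ω - (b + ε)) 0 ∂P) - ∫ ω, max (X ω - (a + ε)) 0 ∂P := by
  rw [← integral_sub (integrable_call hY _) (integrable_call hY _),
    ← integral_sub (integrable_call hX _) (integrable_call hX _)]
  refine integral_mono_ae ((integrable_call hY _).sub (integrable_call hY _))
    ((integrable_call hX _).sub (integrable_call hX _)) ?_
  filter_upwards [h] with ω hω
  have := call_diff_antitone hab (show X ω - ε ≤ Y ω by linarith [(abs_le.1 hω).2])
  simpa only [Pi.sub_apply, sub_sub, add_comm ε] using this

theorem call_sub_le_call_sub' (hX : Integrable X P) (hY : Integrable Y P)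
    (h : ∀ᵐ ω ∂P, |X ω - Y ω| ≤ ε) {a b : ℝ} (hab : a ≤ b) :
    (∫ ω, max (Y ω - a) 0 ∂P) - ∫ ω, max (Y ω - b) 0 ∂P ≤
      (∫ ω, max (X ω - (a - ε)) 0 ∂P) - ∫ ω, max (X ω - (b - ε)) 0 ∂P := by
  rw [← integral_sub (integrable_call hY _) (integrable_call hY _),
    ← integral_sub (integrable_call hX _) (integrable_call hX _)]
  refine integral_mono_ae ((integrable_call hY _).sub (integrable_call hY _))
    ((integrable_call hX _).sub (integrable_call hX _)) ?_
  filter_upwards [h] with ω hω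
  have := call_diff_antitone hab (show Y ω ≤ X ω + ε by linarith [(abs_le.1 hω).1])
  have e : ∀ c, X ω + ε - c = X ω - (c - ε) := fun c => by ring
  simp only [e] at this
  linarith

theorem call_add_le (hX : Integrable X P) (hY : Integrable Y P)
    (h : ∀ᵐ ω ∂P, |X ω - Y ω| ≤ ε) (k : ℝ) :
    ∫ ω, max (X ω - (k + ε)) 0 ∂P ≤ ∫ ω, max (Y ω - k) 0 ∂P := by
  refine integral_mono_ae (integrable_call hX _) (integrable_call hY _) ?_
  filter_upwards [h] with ω hω
  exact max_le_max_right 0 (by linarith [(abs_le.1 hω).2])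

theorem call_le_sub (hX : Integrable X P) (hY : Integrable Y P)
    (h : ∀ᵐ ω ∂P, |X ω - Y ω| ≤ ε) (k : ℝ) :
    ∫ ω, max (Y ω - k) 0 ∂P ≤ ∫ ω, max (X ω - (k - ε)) 0 ∂P := by
  refine integral_mono_ae (integrable_call hY _) (integrable_call hX _) ?_
  filter_upwards [h] with ω hω
  exact max_le_max_right 0 (by linarith [(abs_le.1 hω).1])

/-- Put-call parity turns this into (k - Y)⁺ ≤ (k + ε - X)⁺. The bound ε ≤ X makes the call at
strike ε equal to X - ε, so that its price encodes the mean of X. -/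
theorem call_le_mean_add (hX : Integrable X P) (hY : Integrable Y P)
    (h : ∀ᵐ ω ∂P, |X ω - Y ω| ≤ ε) (hε : ∀ᵐ ω ∂P, ε ≤ X ω) (k : ℝ) :
    ∫ ω, max (Y ω - k) 0 ∂P ≤
      ∫ ω, Y ω ∂P + ∫ ω, max (X ω - (k + ε)) 0 ∂P - ∫ ω, max (X ω - ε) 0 ∂P := by
  have i : Integrable (fun ω => Y ω + max (X ω - (k + ε)) 0) P :=
    hY.add (integrable_call hX (k + ε))
  rw [← integral_add hY (integrable_call hX _), ← integral_sub i (integrable_call hX _)]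
  refine integral_mono_ae (integrable_call hY _) (i.sub (integrable_call hX _)) ?_
  filter_upwards [h, hε] with ω hω hω'
  have := abs_le.1 hω
  rw [max_eq_left (show 0 ≤ X ω - ε by linarith)]
  refine max_le ?_ ?_
  · linarith [le_max_left (X ω - (k + ε)) 0, le_max_right (X ω - (k + ε)) 0]
  · linarith [le_max_left (X ω - (k + ε)) 0, le_max_right (X ω - (k + ε)) 0]

/-- The companion put inequality (k - ε - X)⁺ ≤ (k - Y)⁺, again rewritten by parity. -/
theorem mean_sub_le_call (hX : Integrable X P) (hY : Integrable Y P)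
    (h : ∀ᵐ ω ∂P, |X ω - Y ω| ≤ ε) (hε : ∀ᵐ ω ∂P, ε ≤ X ω) (k : ℝ) :
    ∫ ω, Y ω ∂P - 2 * ε - ∫ ω, max (X ω - ε) 0 ∂P + ∫ ω, max (X ω - (k - ε)) 0 ∂P ≤
      ∫ ω, max (Y ω - k) 0 ∂P := by
  have i₀ : Integrable (fun ω => Y ω - 2 * ε) P := hY.sub (integrable_const _)
  have i₁ : Integrable (fun ω => Y ω - 2 * ε - max (X ω - ε) 0) P :=
    i₀.sub (integrable_call hX ε)
  have e : ∫ ω, Y ω ∂P - 2 * ε = ∫ ω, (Y ω - 2 * ε) ∂P := by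
    rw [integral_sub hY (integrable_const _)]; simp
  rw [e, ← integral_sub i₀ (integrable_call hX _), ← integral_add i₁ (integrable_call hX _)]
  refine integral_mono_ae (i₁.add (integrable_call hX _)) (integrable_call hY _) ?_
  filter_upwards [h, hε] with ω hω hω'
  have := abs_le.1 hω
  rw [max_eq_left (show 0 ≤ X ω - ε by linarith)]
  rcases max_cases (X ω - (k - ε)) 0 with h1 | h1
  · linarith [le_max_left (Y ω - k) 0]
  · linarith [le_max_right (Y ω - k) 0]

/-- Jensen's inequality by hand: exercise at time j exactly on the event {Z i > k}, which is already
known at time i. -/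
theorem call_martingale_mono {ι : Type*} [Preorder ι] {ℱ : Filtration ι m} {Z : ι → Ω → ℝ}
    (hZ : Martingale Z ℱ P) {i j : ι} (hij : i ≤ j) (k : ℝ) :
    ∫ ω, max (Z i ω - k) 0 ∂P ≤ ∫ ω, max (Z j ω - k) 0 ∂P := by
  let s : Set Ω := {ω | k < Z i ω}
  have hs : MeasurableSet[ℱ i] s :=
    (hZ.stronglyAdapted i).measurable measurableSet_Ioi
  have hs' : MeasurableSet s := ℱ.le i s hs
  have e : ∫ ω, max (Z i ω - k) 0 ∂P = ∫ ω in s, (Z i ω - k) ∂P := by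
    rw [← integral_indicator hs']
    congr 1
    ext ω
    by_cases h : ω ∈ s
    · rw [Set.indicator_of_mem h, max_eq_left (sub_nonneg.2 (le_of_lt h))]
    · rw [Set.indicator_of_notMem h, max_eq_right (sub_nonpos.2 (not_lt.1 h))]
  have hc : IntegrableOn (fun _ : Ω => k) s P := (integrable_const k).integrableOn
  rw [e, integral_sub (hZ.integrable i).integrableOn hc, hZ.setIntegral_eq hij hs,
    ← integral_sub (hZ.integrable j).integrableOn hc]
  calc ∫ ω in s, (Z j ω - k) ∂P ≤ ∫ ω in s, max (Z j ω - k) 0 ∂P :=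
        setIntegral_mono ((hZ.integrable j).sub (integrable_const k)).integrableOn
          (integrable_call (hZ.integrable j) k).integrableOn fun ω => le_max_left _ _
    _ ≤ _ := setIntegral_le_integral (integrable_call (hZ.integrable j) k)
          (Filter.Eventually.of_forall fun ω => le_max_right _ _)

end CallBounds

theorem pathConditions_of_epsConsistentNonneg {D : MarketData} {ε S₀ : ℝ} {R : ℕ → ℝ → ℝ}
    {μ : ℕ → Measure ℝ} (hA : SimplifyingAssumptions D ε S₀ R μ)
    (h : EpsConsistentNonneg D ε) : PathConditions D.T R ε S₀ := by
  obtain ⟨M, hM⟩ := h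
  let _ := M.mΩ
  have := M.isProb
  obtain ⟨S, hS, hmart⟩ := hM.consistent.exists_price_system
  let X : Fin (D.T + 1) → M.Ω → ℝ := fun t ω => (D.B t)⁻¹ * M.ref t ω
  let Y : Fin (D.T + 1) → M.Ω → ℝ := fun t ω => (D.B t)⁻¹ * S t ω
  have hB : ∀ t : Fin (D.T + 1), 0 < D.B t := fun t => D.B_pos t (by omega)
  have hXY : ∀ t, ∀ᵐ ω ∂M.P, |X t ω - Y t ω| ≤ ε := by
    intro t
    filter_upwards [hS t, M.bid_le_ref t, M.ref_le_ask t, hM.spread_le t] with ω h1 h2 h3 h4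
    have : X t ω - Y t ω = (M.ref t ω - S t ω) / D.B t := by simp only [X, Y]; ring
    rw [this, abs_div, abs_of_pos (hB t), div_le_iff₀ (hB t), abs_le]
    constructor <;> linarith [h1.1, h1.2]
  have hεX : ∀ t, ∀ᵐ ω ∂M.P, ε ≤ X t ω := by
    intro t
    filter_upwards [hM.le_ref t] with ω h1
    simp only [X]
    rw [inv_mul_eq_div, le_div_iff₀ (hB t)]
    exact h1
  have hYi : ∀ t, Integrable (Y t) M.P := hmart.integrable
  have hXi : ∀ t, Integrable (X t) M.P := by
    intro t
    have hm : AEStronglyMeasurable (X t) M.P :=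
      (((M.adapted_ref t).mono (M.ℱ.le t)).const_mul _).aestronglyMeasurable
    -- Integrability of the reference price is inherited from the martingale through the bounded
    -- difference.
    have hd : Integrable (fun ω => X t ω - Y t ω) M.P :=
      Integrable.of_bound (hm.sub (hYi t).1) ε (hXY t)
    have := hd.add (hYi t)
    refine this.congr (Filter.Eventually.of_forall fun ω => ?_)
    simp
  have hmean : ∀ t, ∫ ω, Y t ω ∂M.P = S₀ := by
    intro t
    have := hmart.setIntegral_eq (Fin.zero_le t) (MeasurableSet.univ)
    simp only [Measure.restrict_univ] at this
    change _ = ∫ ω, Y t ω ∂M.P at this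
    rw [← this]
    have h0 : ∀ᵐ ω ∂M.P, Y 0 ω = S₀ := by
      filter_upwards [hS 0, hM.consistent.bid_zero, hM.consistent.ask_zero] with ω h1 h2 h3
      rw [h2, h3, hA.bid₀_eq, hA.ask₀_eq] at h1
      simp [Y, D.B_zero, le_antisymm h1.2 h1.1]
    change ∫ ω, Y 0 ω ∂M.P = S₀
    rw [integral_congr_ae h0]
    simp
  have hR : ∀ t (h1 : 1 ≤ t) (hT : t ≤ D.T), ∀ k,
      R t k = ∫ ω, max (X ⟨t, by omega⟩ ω - k) 0 ∂M.P := by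
    intro t h1 hT k
    have := hM.consistent.option_price ⟨t, by omega⟩ h1 k
      (by rw [hA.strikes_eq t h1 hT]; trivial)
    simp only [hA.optBid_eq t h1 hT, hA.optAsk_eq t h1 hT] at this
    exact le_antisymm this.1 this.2
  let C : ℕ → ℝ → ℝ := fun t k =>
    if ht : t ≤ D.T then ∫ ω, max (Y ⟨t, by omega⟩ ω - k) 0 ∂M.P else 0
  have hC : ∀ t (ht : t ≤ D.T) k, C t k = ∫ ω, max (Y ⟨t, by omega⟩ ω - k) 0 ∂M.P :=
    fun t ht k => dif_pos ht
  refine pathConditions_of_increasing (C := C) ?_ ?_ ?_ ?_ ?_ ?_ ?_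
  · intro t h1 hT a b hab
    rw [hC t hT, hC t hT, hR t h1 hT, hR t h1 hT]
    exact call_sub_le_call_sub (hXi _) (hYi _) (hXY _) hab
  · intro t h1 hT a b hab
    rw [hC t hT, hC t hT, hR t h1 hT, hR t h1 hT]
    exact call_sub_le_call_sub' (hXi _) (hYi _) (hXY _) hab
  · intro t h1 hT k
    rw [hC t hT, hR t h1 hT]
    exact call_add_le (hXi _) (hYi _) (hXY _) k
  · intro t h1 hT k
    rw [hC t hT, hR t h1 hT]
    exact call_le_sub (hXi _) (hYi _) (hXY _) k
  · intro t h1 hT k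
    rw [hC t hT, hR t h1 hT, hR t h1 hT, ← hmean ⟨t, by omega⟩]
    exact call_le_mean_add (hXi _) (hYi _) (hXY _) (hεX _) k
  · intro t h1 hT k
    rw [hC t hT, hR t h1 hT, hR t h1 hT, ← hmean ⟨t, by omega⟩]
    exact mean_sub_le_call (hXi _) (hYi _) (hXY _) (hεX _) k
  · intro t h1 hT k
    rw [hC t (by omega), hC (t + 1) hT]
    exact call_martingale_mono (Z := Y) hmart (Fin.mk_le_mk.2 (Nat.le_succ t)) k

/-! ### Quantile coupling of finite laws -/

section Coupling

/-- Consecutive cumulative sums leave no gaps: the value just before an atom is the value at the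
preceding atom, so the increments of any h telescope. -/
theorem sum_cdf_telescope {β : Type*} [LinearOrder β] (q : β → ℝ) (h : ℝ → ℝ) (s : Finset β) :
    ∑ b ∈ s, (h (∑ c ∈ s with c ≤ b, q c) - h (∑ c ∈ s with c < b, q c)) =
      h (∑ c ∈ s, q c) - h 0 := by
  induction s using Finset.induction_on_max with
  | empty => simp
  | insert a s ha ih =>
    have hna : a ∉ s := fun h => lt_irrefl _ (ha a h)
    rw [Finset.sum_insert hna]
    have e₁ : (insert a s).filter (· ≤ a) = insert a s :=
      Finset.filter_true_of_mem fun x hx => by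
        rcases Finset.mem_insert.1 hx with rfl | hx
        · exact le_rfl
        · exact (ha x hx).le
    have e₂ : (insert a s).filter (· < a) = s := by
      rw [Finset.filter_insert, if_neg (lt_irrefl a)]
      exact Finset.filter_true_of_mem ha
    have e₃ : ∀ b ∈ s, h (∑ c ∈ insert a s with c ≤ b, q c) -
        h (∑ c ∈ insert a s with c < b, q c) =
        h (∑ c ∈ s with c ≤ b, q c) - h (∑ c ∈ s with c < b, q c) := by
      intro b hb
      rw [Finset.filter_insert, Finset.filter_insert, if_neg (not_le.2 (ha b hb)),
        if_neg (not_lt.2 (ha b hb).le)]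
    rw [e₁, e₂, Finset.sum_congr rfl e₃, ih]
    ring

/-- The length of the intersection of the intervals `[l, r]` and `[l', r']`. -/
noncomputable def overlap (l r l' r' : ℝ) : ℝ := max l (min r r') - max l (min r l')

theorem overlap_comm {l r l' r' : ℝ} (h : l ≤ r) (h' : l' ≤ r') :
    overlap l r l' r' = overlap l' r' l r := by
  unfold overlap
  grind

theorem overlap_nonneg {l r l' r' : ℝ} (h' : l' ≤ r') : 0 ≤ overlap l r l' r' := by
  unfold overlap
  exact sub_nonneg.2 (max_le_max_left _ (min_le_min_left _ h'))

theorem lt_of_overlap_ne_zero {l r l' r' : ℝ} (h : l ≤ r) (h' : l' ≤ r')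
    (hne : overlap l r l' r' ≠ 0) : l < r' ∧ l' < r := by
  unfold overlap at hne
  grind

theorem cdf_bounds {γ : Type*} [Fintype γ] [LinearOrder γ] {r : γ → ℝ} (hr : ∀ c, 0 ≤ r c)
    (hr₁ : ∑ c, r c = 1) (a : γ) : 0 ≤ ∑ c with c < a, r c ∧ ∑ c with c ≤ a, r c ≤ 1 ∧
      ∑ c with c < a, r c + r a = ∑ c with c ≤ a, r c := by
  refine ⟨Finset.sum_nonneg fun c _ => hr c, ?_, ?_⟩
  · rw [← hr₁]
    exact Finset.sum_le_sum_of_subset_of_nonneg (Finset.filter_subset _ _) fun c _ _ => hr c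
  · have : (Finset.univ.filter (· ≤ a) : Finset γ) = insert a (Finset.univ.filter (· < a)) := by
      ext c
      simp [le_iff_eq_or_lt]
    rw [this, Finset.sum_insert (by simp)]
    ring

/-- Quantile coupling of two finitely supported probability vectors. -/
theorem exists_monotone_coupling {α β : Type*} [Fintype α] [LinearOrder α] [Fintype β]
    [LinearOrder β] {p : α → ℝ} {q : β → ℝ} (hp : ∀ a, 0 ≤ p a) (hq : ∀ b, 0 ≤ q b)
    (hp₁ : ∑ a, p a = 1) (hq₁ : ∑ b, q b = 1) :
    ∃ J : α → β → ℝ, (∀ a b, 0 ≤ J a b) ∧ (∀ a, ∑ b, J a b = p a) ∧ (∀ b, ∑ a, J a b = q b) ∧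
      ∀ a b, J a b ≠ 0 → ∑ c with c < a, p c < ∑ c with c ≤ b, q c ∧
        ∑ c with c < b, q c < ∑ c with c ≤ a, p c := by
  have hα := cdf_bounds hp hp₁
  have hβ := cdf_bounds hq hq₁
  have hα' : ∀ a, ∑ c with c < a, p c ≤ ∑ c with c ≤ a, p c := fun a => by
    linarith [(hα a).2.2, hp a]
  have hβ' : ∀ a, ∑ c with c < a, q c ≤ ∑ c with c ≤ a, q c := fun a => by
    linarith [(hβ a).2.2, hq a]
  refine ⟨fun a b => overlap (∑ c with c < a, p c) (∑ c with c ≤ a, p c)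
    (∑ c with c < b, q c) (∑ c with c ≤ b, q c), fun a b => overlap_nonneg (hβ' b), ?_, ?_,
    fun a b h => lt_of_overlap_ne_zero (hα' a) (hβ' b) h⟩
  · intro a
    unfold overlap
    -- An overlap is an increment of the map clamping v to the quantile interval of a. Over all b
    -- these telescope to the length of that interval.
    rw [sum_cdf_telescope q (fun v => max (∑ c with c < a, p c) (min (∑ c with c ≤ a, p c) v))
      Finset.univ, hq₁, min_eq_left (hα a).2.1, max_eq_right (hα' a),
      min_eq_right ((hα a).1.trans (hα' a)), max_eq_left (hα a).1]
    linarith [(hα a).2.2]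
  · intro b
    have : ∀ a, overlap (∑ c with c < a, p c) (∑ c with c ≤ a, p c)
        (∑ c with c < b, q c) (∑ c with c ≤ b, q c) = overlap (∑ c with c < b, q c)
        (∑ c with c ≤ b, q c) (∑ c with c < a, p c) (∑ c with c ≤ a, p c) :=
      fun a => overlap_comm (hα' a) (hβ' b)
    simp only [this]
    unfold overlap
    rw [sum_cdf_telescope p (fun v => max (∑ c with c < b, q c) (min (∑ c with c ≤ b, q c) v))
      Finset.univ, hp₁, min_eq_left (hβ b).2.1, max_eq_right (hβ' b),
      min_eq_right ((hβ b).1.trans (hβ' b)), max_eq_left (hβ b).1]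
    linarith [(hβ b).2.2]

end Coupling

/-! ### Strassen's theorem by separation -/

section Strassen

variable {α β : Type*} [Fintype α] [Fintype β]

/-- Strassen's theorem for finitely supported probability vectors. -/
theorem exists_martingale_coupling [Nonempty α] {p : α → ℝ} {q : β → ℝ} (y : α → ℝ) (z : β → ℝ)
    (hp₁ : ∑ a, p a = 1) (hp : ∀ a, 0 ≤ p a) (hq : ∀ b, 0 ≤ q b)
    (hconv : ∀ φ : ℝ → ℝ, ConvexOn ℝ Set.univ φ → ∑ a, p a * φ (y a) ≤ ∑ b, q b * φ (z b)) :
    ∃ J : α → β → ℝ, (∀ a b, 0 ≤ J a b) ∧ (∀ a, ∑ b, J a b = p a) ∧ (∀ b, ∑ a, J a b = q b) ∧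
      ∀ a, ∑ b, J a b * (z b - y a) = 0 := by
  classical
  let L : (α × β → ℝ) →ₗ[ℝ] (α ⊕ β ⊕ α → ℝ) :=
    { toFun := fun w => Sum.elim (fun a => ∑ b, w (a, b))
        (Sum.elim (fun b => ∑ a, w (a, b)) fun a => ∑ b, w (a, b) * (z b - y a))
      map_add' := fun w w' => by
        ext (a | b | a) <;> simp [Finset.sum_add_distrib, add_mul]
      map_smul' := fun c w => by
        ext (a | b | a) <;> simp [Finset.mul_sum, mul_assoc] }
  -- K collects the marginals and the drift terms of all joint laws, and a martingale coupling is a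
  -- preimage of v. K is compact and convex, so v outside K could be strictly separated from it.
  let K := L '' stdSimplex ℝ (α × β)
  let v : α ⊕ β ⊕ α → ℝ := Sum.elim p (Sum.elim q fun _ => 0)
  by_cases hmem : v ∈ K
  · obtain ⟨w, hw, hL⟩ := hmem
    exact ⟨fun a b => w (a, b), fun a b => hw.1 _, fun a => congrFun hL (.inl a),
      fun b => congrFun hL (.inr (.inl b)), fun a => congrFun hL (.inr (.inr a))⟩
  exfalso
  have hLc : Continuous L := L.continuous_of_finiteDimensional
  obtain ⟨f, u, hfu, hf⟩ := geometric_hahn_banach_point_closed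
    ((convex_stdSimplex ℝ (α × β)).linear_image L)
    ((isCompact_stdSimplex ℝ (α × β)).image hLc).isClosed hmem
  obtain ⟨c, hc⟩ : ∃ c : α ⊕ β ⊕ α → ℝ, ∀ x, f x = ∑ i, x i * c i :=
    ⟨_, fun x => LinearMap.pi_apply_eq_sum_univ (f : (α ⊕ β ⊕ α → ℝ) →ₗ[ℝ] ℝ) x⟩
  simp only [hc, Fintype.sum_sum_type] at hfu hf
  have hbd : ∀ a b, u - c (.inl a) - c (.inr (.inr a)) * (z b - y a) ≤ c (.inr (.inl b)) := by
    intro a b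
    have := hf _ ⟨Pi.single (a, b) 1, single_mem_stdSimplex ℝ (a, b), rfl⟩
    have e₁ : ∀ a', ∑ b', (Pi.single (a, b) (1 : ℝ) : α × β → ℝ) (a', b') =
        if a' = a then 1 else 0 := by
      intro a'
      by_cases h : a' = a <;> simp [Pi.single_apply, h]
    have e₂ : ∀ b', ∑ a', (Pi.single (a, b) (1 : ℝ) : α × β → ℝ) (a', b') =
        if b' = b then 1 else 0 := by
      intro b'
      by_cases h : b' = b <;> simp [Pi.single_apply, h]
    have e₃ : ∀ a', ∑ b', (Pi.single (a, b) (1 : ℝ) : α × β → ℝ) (a', b') * (z b' - y a') =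
        if a' = a then z b - y a else 0 := by
      intro a'
      by_cases h : a' = a <;> simp [Pi.single_apply, h]
    simp only [L, LinearMap.coe_mk, AddHom.coe_mk, Sum.elim_inl, Sum.elim_inr, e₁, e₂, e₃, ite_mul,
      one_mul, zero_mul, Finset.sum_ite_eq', Finset.mem_univ, if_true] at this
    linarith
  -- Testing the separating functional on point masses bounds one affine function per a by the
  -- weight of b at `z b`. Their upper envelope is the convex function that contradicts the
  -- separation.
  let φ : ℝ → ℝ := fun x => Finset.univ.sup' Finset.univ_nonempty
    fun a => u - c (.inl a) - c (.inr (.inr a)) * (x - y a)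
  have hφ : ConvexOn ℝ Set.univ φ := by
    refine ⟨convex_univ, fun x _ x' _ s t hs ht hst => Finset.sup'_le _ _ fun a _ => ?_⟩
    have h1 : u - c (.inl a) - c (.inr (.inr a)) * (x - y a) ≤ φ x :=
      Finset.le_sup' (fun a => u - c (.inl a) - c (.inr (.inr a)) * (x - y a)) (Finset.mem_univ a)
    have h2 : u - c (.inl a) - c (.inr (.inr a)) * (x' - y a) ≤ φ x' :=
      Finset.le_sup' (fun a => u - c (.inl a) - c (.inr (.inr a)) * (x' - y a)) (Finset.mem_univ a)
    have h3 := add_le_add (mul_le_mul_of_nonneg_left h1 hs) (mul_le_mul_of_nonneg_left h2 ht)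
    refine le_trans (le_of_eq ?_) h3
    obtain rfl : s = 1 - t := by linarith
    simp only [smul_eq_mul]
    ring
  have h₁ : ∑ a, p a * (u - c (.inl a)) ≤ ∑ a, p a * φ (y a) := by
    refine Finset.sum_le_sum fun a _ => mul_le_mul_of_nonneg_left ?_ (hp a)
    have : u - c (.inl a) - c (.inr (.inr a)) * (y a - y a) ≤ φ (y a) :=
      Finset.le_sup' (fun a' => u - c (.inl a') - c (.inr (.inr a')) * (y a - y a'))
        (Finset.mem_univ a)
    simpa using this
  have h₂ : ∑ b, q b * φ (z b) ≤ ∑ b, q b * c (.inr (.inl b)) :=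
    Finset.sum_le_sum fun b _ => mul_le_mul_of_nonneg_left
      (Finset.sup'_le _ _ fun a _ => hbd a b) (hq b)
  have h₃ := hconv φ hφ
  simp only [mul_sub, Finset.sum_sub_distrib, ← Finset.sum_mul, hp₁] at h₁
  simp only [v, Sum.elim_inl, Sum.elim_inr, zero_mul, Finset.sum_const_zero] at hfu
  linarith

end Strassen

/-! ### Discrete convex analysis on a grid -/

section Grid

/-- Difference quotients of a sequence over a grid. -/
noncomputable def gridSlope (g c : ℕ → ℝ) (i : ℕ) : ℝ := (c (i + 1) - c i) / (g (i + 1) - g i)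

variable {g : ℕ → ℝ}

theorem gridSlope_mul (hg : StrictMono g) (c : ℕ → ℝ) (i : ℕ) :
    gridSlope g c i * (g (i + 1) - g i) = c (i + 1) - c i :=
  div_mul_cancel₀ _ (sub_pos.2 (hg (Nat.lt_succ_self i))).ne'

/-- A function on a grid is an affine function plus a combination of call payoffs. -/
theorem grid_eq_sum_calls (hg : StrictMono g) (c : ℕ → ℝ) {n j : ℕ} (hj : j ≤ n) :
    c j = c 0 + gridSlope g c 0 * (g j - g 0) + ∑ i ∈ Finset.range n,
      (gridSlope g c (i + 1) - gridSlope g c i) * max (g j - g (i + 1)) 0 := by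
  -- Without positive parts, the first m terms give the line extending the segment over [g m, g (m +
  -- 1)].
  have key : ∀ m x, c 0 + gridSlope g c 0 * (x - g 0) + ∑ i ∈ Finset.range m,
      (gridSlope g c (i + 1) - gridSlope g c i) * (x - g (i + 1)) =
        c m + gridSlope g c m * (x - g m) := by
    intro m x
    induction m with
    | zero => simp
    | succ m ih =>
      rw [Finset.sum_range_succ, ← add_assoc, ih]
      linear_combination gridSlope_mul hg c m
  have h₀ := key j (g j)
  rw [sub_self, mul_zero, add_zero] at h₀
  rw [← h₀]
  congr 1
  have hsub : Finset.range j ⊆ Finset.range n := Finset.range_subset_range.2 hj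
  rw [← Finset.sum_subset hsub fun i _ hi => ?_]
  · refine Finset.sum_congr rfl fun i hi => ?_
    rw [max_eq_left (sub_nonneg.2 (hg.monotone (Finset.mem_range.1 hi)))]
  · rw [max_eq_right (sub_nonpos.2 (hg.monotone _)), mul_zero]
    rw [Finset.mem_range] at hi
    omega

/-- The second differences of `c` are point masses whose call function on the grid is `c`. -/
theorem sum_masses_call (hg : StrictMono g) (c : ℕ → ℝ) {N : ℕ} (hN : c N = 0)
    (hN' : c (N + 1) = 0) {i : ℕ} (hi : i ≤ N) :
    ∑ j ∈ Finset.range N,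
      (gridSlope g c (j + 1) - gridSlope g c j) * max (g (j + 1) - g i) 0 = c i := by
  -- The partial sum is c i minus the value at g i of the line through the n-th segment. For n = N
  -- that line vanishes.
  have key : ∀ n, i ≤ n → ∑ j ∈ Finset.range n,
      (gridSlope g c (j + 1) - gridSlope g c j) * max (g (j + 1) - g i) 0 =
        gridSlope g c n * (g n - g i) - c n + c i := by
    intro n hn
    induction n, hn using Nat.le_induction with
    | base =>
      rw [Finset.sum_eq_zero fun j hj => ?_]
      · ring
      · rw [max_eq_right (sub_nonpos.2 (hg.monotone (Finset.mem_range.1 hj))), mul_zero]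
    | succ n hn ih =>
      rw [Finset.sum_range_succ, ih, max_eq_left (sub_nonneg.2 (hg.monotone (by omega)))]
      linear_combination - gridSlope_mul hg c n
  rw [key N hi, hN, gridSlope, hN, hN']
  simp

theorem sum_grid_eq_sum_calls {γ : Type*} [Fintype γ] (hg : StrictMono g) (c : ℕ → ℝ) {N : ℕ}
    {r : γ → ℝ} (hr : ∑ a, r a = 1) {ι : γ → ℕ} (hι : ∀ a, ι a ≤ N) :
    ∑ a, r a * c (ι a) = c 0 - gridSlope g c 0 * g 0 + gridSlope g c 0 * ∑ a, r a * g (ι a) +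
      ∑ i ∈ Finset.range N, (gridSlope g c (i + 1) - gridSlope g c i) *
        ∑ a, r a * max (g (ι a) - g (i + 1)) 0 := by
  have e : ∀ a, r a * c (ι a) = r a * (c 0 - gridSlope g c 0 * g 0) +
      gridSlope g c 0 * (r a * g (ι a)) + ∑ i ∈ Finset.range N,
        (gridSlope g c (i + 1) - gridSlope g c i) * (r a * max (g (ι a) - g (i + 1)) 0) := by
    intro a
    rw [grid_eq_sum_calls hg c (hι a), mul_add, Finset.mul_sum]
    refine congrArg₂ (· + ·) (by ring) (Finset.sum_congr rfl fun i _ => by ring)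
  rw [Finset.sum_congr rfl fun a _ => e a, Finset.sum_add_distrib, Finset.sum_add_distrib,
    ← Finset.sum_mul, hr, one_mul, ← Finset.mul_sum, Finset.sum_comm]
  simp only [Finset.mul_sum]

/-- Ordered call functions and equal means imply the convex order, for laws on a grid. -/
theorem convex_order_of_calls {α β : Type*} [Fintype α] [Fintype β] (hg : StrictMono g) {N : ℕ}
    {p : α → ℝ} {q : β → ℝ} (hp₁ : ∑ a, p a = 1) (hq₁ : ∑ b, q b = 1) {ia : α → ℕ} {ib : β → ℕ}
    (hia : ∀ a, ia a ≤ N) (hib : ∀ b, ib b ≤ N)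
    (hmean : ∑ a, p a * g (ia a) = ∑ b, q b * g (ib b))
    (hcall : ∀ i ≤ N, ∑ a, p a * max (g (ia a) - g i) 0 ≤ ∑ b, q b * max (g (ib b) - g i) 0)
    {φ : ℝ → ℝ} (hφ : ConvexOn ℝ Set.univ φ) :
    ∑ a, p a * φ (g (ia a)) ≤ ∑ b, q b * φ (g (ib b)) := by
  rw [sum_grid_eq_sum_calls hg (fun i => φ (g i)) hp₁ hia,
    sum_grid_eq_sum_calls hg (fun i => φ (g i)) hq₁ hib, hmean]
  refine add_le_add_right (Finset.sum_le_sum fun i hi => mul_le_mul_of_nonneg_left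
    (hcall _ (Finset.mem_range.1 hi)) (sub_nonneg.2 ?_)) _
  exact hφ.slope_mono_adjacent (Set.mem_univ _) (Set.mem_univ _) (hg (Nat.lt_succ_self i))
    (hg (Nat.lt_succ_self (i + 1)))

/-- Any finite set of reals is contained in a strictly increasing sequence. -/
theorem exists_grid (s : Finset ℝ) : ∃ (g : ℕ → ℝ) (N : ℕ), StrictMono g ∧
    ∀ x ∈ s, ∃ i < N, g (i + 1) = x := by
  obtain ⟨b, hb⟩ : ∃ b, ∀ x ∈ s, b < x := by
    obtain ⟨b, hb⟩ := s.bddBelow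
    exact ⟨b - 1, fun x hx => by linarith [hb hx]⟩
  -- The induction must also know that the first N + 1 grid values are b and elements of s, so that
  -- a new maximum can be appended after them.
  suffices h : ∃ (g : ℕ → ℝ) (N : ℕ), StrictMono g ∧ (g 0 = b ∧ ∀ i < N, g (i + 1) ∈ s) ∧
      ∀ x ∈ s, ∃ i < N, g (i + 1) = x by
    obtain ⟨g, N, h₁, _, h₂⟩ := h
    exact ⟨g, N, h₁, h₂⟩
  induction s using Finset.induction_on_max with
  | empty => exact ⟨fun i => b + i, 0, fun i j h => by simpa using h, by simp, by simp⟩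
  | insert a s ha ih =>
    obtain ⟨g, N, hg, ⟨h0, hgs⟩, hs⟩ := ih fun x hx => hb x (Finset.mem_insert_of_mem hx)
    refine ⟨fun i => if i ≤ N then g i else a + (i - (N + 1) : ℕ), N + 1, ?_, ⟨by simp [h0], ?_⟩,
      ?_⟩
    · refine strictMono_nat_of_lt_succ fun i => ?_
      rcases lt_trichotomy i N with h | rfl | h
      · rw [if_pos h.le, if_pos (by omega)]
        exact hg (Nat.lt_succ_self i)
      · rw [if_pos le_rfl, if_neg (by omega)]
        simp only [Nat.sub_self, Nat.cast_zero, add_zero]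
        rcases i with _ | i
        · rw [h0]; exact hb a (Finset.mem_insert_self _ _)
        · exact ha _ (hgs i (by omega))
      · rw [if_neg (by omega), if_neg (by omega)]
        gcongr
        omega
    · intro i hi
      rcases Nat.lt_succ_iff_lt_or_eq.1 hi with h | rfl
      · simp only [if_pos (show i + 1 ≤ N by omega)]
        exact Finset.mem_insert_of_mem (hgs i h)
      · simp
    · intro x hx
      rcases Finset.mem_insert.1 hx with rfl | hx
      · exact ⟨N, by omega, by simp⟩
      · obtain ⟨i, hi, rfl⟩ := hs x hx
        exact ⟨i, by omega, by simp only [if_pos (show i + 1 ≤ N by omega)]⟩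

end Grid

/-! ### Minimal call functions -/

section MinimalCalls

variable {R : ℕ → ℝ → ℝ} {ε S₀ : ℝ}

/-- The asymmetric distance for which the call functions of the laws within `ε` of the law with
call function `R t` are nonexpansive. -/
noncomputable def callDist (R : ℕ → ℝ → ℝ) (ε : ℝ) (t : ℕ) (x y : ℝ) : ℝ :=
  max (R t (y + ε) - R t (x + ε)) (R t (y - ε) - R t (x - ε))

/-- The smallest call function with mean `S₀` within `ε` of `R 1`. -/
noncomputable def lowerCall (R : ℕ → ℝ → ℝ) (ε S₀ x : ℝ) : ℝ :=
  max (R 1 (x + ε)) (R 1 (x - ε) + (S₀ - 2 * ε - R 1 ε))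

/-- An upper bound for the call functions with mean `S₀` within `ε` of `R t`. -/
noncomputable def upperCall (R : ℕ → ℝ → ℝ) (ε S₀ : ℝ) (t : ℕ) (x : ℝ) : ℝ :=
  min (R t (x - ε)) (R t (x + ε) + (S₀ - R t ε))

/-- The smallest increasing sequence of functions on the grid `g 0, …, g (N + 1)` that starts at
`lowerCall` and is nonexpansive for `callDist`. Its `n`-th term belongs to the maturity `n + 1`. -/
noncomputable def minCall (R : ℕ → ℝ → ℝ) (ε S₀ : ℝ) (g : ℕ → ℝ) (N : ℕ) : ℕ → ℝ → ℝ
  | 0, x => lowerCall R ε S₀ x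
  | n + 1, x => (Finset.range (N + 2)).sup' (by simp)
      fun i => minCall R ε S₀ g N n (g i) - callDist R ε (n + 2) x (g i)

theorem callDist_self (t : ℕ) (x : ℝ) : callDist R ε t x x = 0 := by simp [callDist]

theorem callDist_triangle (t : ℕ) (x y z : ℝ) :
    callDist R ε t x z ≤ callDist R ε t x y + callDist R ε t y z := by
  unfold callDist
  refine max_le ?_ ?_
  · linarith [le_max_left (R t (y + ε) - R t (x + ε)) (R t (y - ε) - R t (x - ε)),
      le_max_left (R t (z + ε) - R t (y + ε)) (R t (z - ε) - R t (y - ε))]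
  · linarith [le_max_right (R t (y + ε) - R t (x + ε)) (R t (y - ε) - R t (x - ε)),
      le_max_right (R t (z + ε) - R t (y + ε)) (R t (z - ε) - R t (y - ε))]

theorem lowerCall_sub_le (x y : ℝ) :
    lowerCall R ε S₀ y - lowerCall R ε S₀ x ≤ callDist R ε 1 x y := by
  unfold callDist lowerCall
  grind

theorem upperCall_sub_le (t : ℕ) (x y : ℝ) :
    upperCall R ε S₀ t y - upperCall R ε S₀ t x ≤ callDist R ε t x y := by
  unfold callDist upperCall
  grind

variable {g : ℕ → ℝ} {N : ℕ}

theorem le_minCall_succ (n : ℕ) (x : ℝ) {i : ℕ} (hi : i ≤ N + 1) :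
    minCall R ε S₀ g N n (g i) - callDist R ε (n + 2) x (g i) ≤ minCall R ε S₀ g N (n + 1) x :=
  Finset.le_sup' (fun i => minCall R ε S₀ g N n (g i) - callDist R ε (n + 2) x (g i))
    (Finset.mem_range.2 (by omega))

theorem exists_minCall_succ_eq (n : ℕ) (x : ℝ) : ∃ i ≤ N + 1, minCall R ε S₀ g N (n + 1) x =
    minCall R ε S₀ g N n (g i) - callDist R ε (n + 2) x (g i) := by
  obtain ⟨i, hi, h⟩ := Finset.exists_mem_eq_sup' (s := Finset.range (N + 2)) (by simp)
    fun i => minCall R ε S₀ g N n (g i) - callDist R ε (n + 2) x (g i)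
  exact ⟨i, by rw [Finset.mem_range] at hi; omega, h⟩

theorem minCall_mono (n : ℕ) {i : ℕ} (hi : i ≤ N + 1) :
    minCall R ε S₀ g N n (g i) ≤ minCall R ε S₀ g N (n + 1) (g i) := by
  simpa [callDist_self] using le_minCall_succ (R := R) (ε := ε) (S₀ := S₀) (g := g) n (g i) hi

theorem lowerCall_le_minCall (n : ℕ) {i : ℕ} (hi : i ≤ N + 1) :
    lowerCall R ε S₀ (g i) ≤ minCall R ε S₀ g N n (g i) := by
  induction n with
  | zero => exact le_rfl
  | succ n ih => exact ih.trans (minCall_mono n hi)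

theorem minCall_sub_le (n : ℕ) (x y : ℝ) :
    minCall R ε S₀ g N n y - minCall R ε S₀ g N n x ≤ callDist R ε (n + 1) x y := by
  cases n with
  | zero => exact lowerCall_sub_le x y
  | succ n =>
    obtain ⟨i, hi, h⟩ := exists_minCall_succ_eq (R := R) (ε := ε) (S₀ := S₀) (g := g) (N := N) n y
    have h₁ := le_minCall_succ (R := R) (ε := ε) (S₀ := S₀) (g := g) n x hi
    have h₂ := callDist_triangle (R := R) (ε := ε) (n + 2) x y (g i)
    rw [h]
    linarith

/-- The strikes k_t are the grid points attaining the successive suprema, read backwards from x. -/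
theorem exists_path_minCall_le (n : ℕ) (x : ℝ) : ∃ k : ℕ → ℝ, k (n + 1) = x ∧
    minCall R ε S₀ g N n x ≤ lowerCall R ε S₀ (k 1) -
      ∑ t ∈ Finset.Icc 2 (n + 1), callDist R ε t (k t) (k (t - 1)) := by
  induction n generalizing x with
  | zero => exact ⟨fun _ => x, rfl, by simp [minCall]⟩
  | succ n ih =>
    obtain ⟨i, hi, h⟩ := exists_minCall_succ_eq (R := R) (ε := ε) (S₀ := S₀) (g := g) (N := N) n x
    obtain ⟨k, hk, hle⟩ := ih (g i)
    refine ⟨Function.update k (n + 2) x, by simp, ?_⟩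
    rw [Finset.sum_Icc_succ_top (by omega), h, Function.update_of_ne (by omega)]
    have : ∑ t ∈ Finset.Icc 2 (n + 1), callDist R ε t (Function.update k (n + 2) x t)
        (Function.update k (n + 2) x (t - 1)) =
        ∑ t ∈ Finset.Icc 2 (n + 1), callDist R ε t (k t) (k (t - 1)) := by
      refine Finset.sum_congr rfl fun t ht => ?_
      rw [Finset.mem_Icc] at ht
      rw [Function.update_of_ne (by omega), Function.update_of_ne (by omega)]
    rw [this]
    simp only [show n + 1 + 1 = n + 2 from rfl, Function.update_self]
    rw [show n + 2 - 1 = n + 1 from rfl, Function.update_of_ne (by omega), hk]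
    linarith

/-- The only place where the path conditions are applied to strikes. The two terms of the maximum in
`lowerCall` against the two of the minimum in `upperCall` are the four conditions. The bound is for
the next maturity, before the majorant is taken. -/
theorem minCall_le_upperCall_succ {T : ℕ} (hP : PathConditions T R ε S₀) {n : ℕ} (hn : n + 2 ≤ T)
    (x : ℝ) : minCall R ε S₀ g N n x ≤ upperCall R ε S₀ (n + 2) x := by
  obtain ⟨k, hk, hle⟩ := exists_path_minCall_le (R := R) (ε := ε) (S₀ := S₀) (g := g) (N := N) n x
  have h := hP (n + 2) (by omega) hn k
  simp only [pathSum_eq, hk, mul_neg, mul_one, ← sub_eq_add_neg] at h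
  have hs : ∑ t ∈ Finset.Icc 2 (n + 1), (R t (k (t - 1) + ε * Real.sign (k (t - 1) - k t)) -
      R t (k t + ε * Real.sign (k (t - 1) - k t))) ≤
      ∑ t ∈ Finset.Icc 2 (n + 1), callDist R ε t (k t) (k (t - 1)) := by
    refine Finset.sum_le_sum fun t _ => ?_
    rcases lt_trichotomy (k (t - 1)) (k t) with h | h | h
    · rw [Real.sign_of_neg (by linarith), mul_neg, mul_one, ← sub_eq_add_neg, ← sub_eq_add_neg]
      exact le_max_right _ _
    · rw [h, callDist_self, sub_self]
    · rw [Real.sign_of_pos (by linarith), mul_one]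
      exact le_max_left _ _
  obtain ⟨h₁, h₂, h₃, h₄⟩ := h
  refine hle.trans ?_
  unfold upperCall lowerCall
  rw [sub_le_iff_le_add]
  refine max_le ?_ ?_ <;> rw [← sub_le_iff_le_add] <;> refine le_min ?_ ?_ <;> linarith

/-- The upper bound is itself nonexpansive, so it survives passing to the smallest nonexpansive
majorant. -/
theorem minCall_le_upperCall {T : ℕ} (hP : PathConditions T R ε S₀)
    (h₀ : ∀ x, lowerCall R ε S₀ x ≤ upperCall R ε S₀ 1 x) {n : ℕ} (hn : n + 1 ≤ T) (x : ℝ) :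
    minCall R ε S₀ g N n x ≤ upperCall R ε S₀ (n + 1) x := by
  cases n with
  | zero => exact h₀ x
  | succ n =>
    obtain ⟨i, hi, h⟩ := exists_minCall_succ_eq (R := R) (ε := ε) (S₀ := S₀) (g := g) (N := N) n x
    have h₁ := minCall_le_upperCall_succ (g := g) (N := N) hP hn (g i)
    have h₂ := upperCall_sub_le (R := R) (ε := ε) (S₀ := S₀) (n + 2) x (g i)
    rw [h]
    linarith

/-- A function supported from below at y by a vertical translate of a function with the chord
property inherits that property at y. -/
theorem chord_of_le {f u : ℝ → ℝ} {K a y b : ℝ} (hay : a ≤ y) (hyb : y ≤ b)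
    (hf : f y * (b - a) ≤ f a * (b - y) + f b * (y - a)) (hy : u y ≤ f y + K)
    (ha : f a + K ≤ u a) (hb : f b + K ≤ u b) :
    u y * (b - a) ≤ u a * (b - y) + u b * (y - a) := by
  have h₁ := mul_le_mul_of_nonneg_right hy (show 0 ≤ b - a by linarith)
  have h₂ := mul_le_mul_of_nonneg_right ha (show 0 ≤ b - y by linarith)
  have h₃ := mul_le_mul_of_nonneg_right hb (show 0 ≤ y - a by linarith)
  nlinarith

/-- The minimal call functions are convex along the grid. -/
theorem minCall_chord (hg : StrictMono g)
    (hchord : ∀ t a y b, a ≤ y → y ≤ b → R t y * (b - a) ≤ R t a * (b - y) + R t b * (y - a))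
    (hdiff : ∀ t a b, a ≤ b → R t (b - ε) - R t (a - ε) ≤ R t (b + ε) - R t (a + ε))
    (n : ℕ) {j : ℕ} (hj : j + 1 ≤ N) :
    minCall R ε S₀ g N n (g (j + 1)) * (g (j + 2) - g j) ≤
      minCall R ε S₀ g N n (g j) * (g (j + 2) - g (j + 1)) +
        minCall R ε S₀ g N n (g (j + 2)) * (g (j + 1) - g j) := by
  have h₁ : g j ≤ g (j + 1) := hg.monotone (by omega)
  have h₂ : g (j + 1) ≤ g (j + 2) := hg.monotone (by omega)
  have hp : ∀ t, R t (g (j + 1) + ε) * (g (j + 2) - g j) ≤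
      R t (g j + ε) * (g (j + 2) - g (j + 1)) + R t (g (j + 2) + ε) * (g (j + 1) - g j) :=
    fun t => by
      simpa only [add_sub_add_right_eq_sub] using hchord t (g j + ε) (g (j + 1) + ε)
        (g (j + 2) + ε) (by linarith) (by linarith)
  have hm : ∀ t, R t (g (j + 1) - ε) * (g (j + 2) - g j) ≤
      R t (g j - ε) * (g (j + 2) - g (j + 1)) + R t (g (j + 2) - ε) * (g (j + 1) - g j) :=
    fun t => by
      simpa only [sub_sub_sub_cancel_right] using hchord t (g j - ε) (g (j + 1) - ε)
        (g (j + 2) - ε) (by linarith) (by linarith)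
  induction n with
  | zero =>
    simp only [minCall]
    rcases max_choice (R 1 (g (j + 1) + ε)) (R 1 (g (j + 1) - ε) + (S₀ - 2 * ε - R 1 ε)) with h | h
    · refine chord_of_le (f := fun x => R 1 (x + ε)) (K := 0) h₁ h₂ (hp 1) ?_ ?_ ?_
      · rw [lowerCall, h, add_zero]
      · rw [add_zero]; exact le_max_left _ _
      · rw [add_zero]; exact le_max_left _ _
    · exact chord_of_le (f := fun x => R 1 (x - ε)) (K := S₀ - 2 * ε - R 1 ε) h₁ h₂ (hm 1) h.le
        (le_max_right _ _) (le_max_right _ _)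
  | succ n ih =>
    obtain ⟨i, hi, h⟩ := exists_minCall_succ_eq (R := R) (ε := ε) (S₀ := S₀) (g := g) (N := N) n
      (g (j + 1))
    have hlow : ∀ x, minCall R ε S₀ g N n (g i) - callDist R ε (n + 2) x (g i) ≤
      minCall R ε S₀ g N (n + 1) x := fun x => le_minCall_succ n x hi
    -- The competitor attached to g i is a shifted copy of R on either side of g i, but may have a
    -- concave kink there. Away from the kink it supports from below; if the maximiser is the kink
    -- itself, the previous function takes over.
    rcases lt_trichotomy i (j + 1) with hij | rfl | hij
    · have hd : ∀ x, g i ≤ x → callDist R ε (n + 2) x (g i) =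
          R (n + 2) (g i - ε) - R (n + 2) (x - ε) := fun x hx =>
        max_eq_right (by linarith [hdiff (n + 2) (g i) x hx])
      have hgi : g i ≤ g j := hg.monotone (by omega)
      refine chord_of_le (f := fun x => R (n + 2) (x - ε))
        (K := minCall R ε S₀ g N n (g i) - R (n + 2) (g i - ε)) h₁ h₂ (hm _) ?_ ?_ ?_
      · rw [h, hd _ (by linarith)]; linarith
      · have := hlow (g j); rw [hd _ (by linarith)] at this; linarith
      · have := hlow (g (j + 2)); rw [hd _ (by linarith)] at this; linarith
    · rw [callDist_self, sub_zero] at h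
      exact chord_of_le (f := minCall R ε S₀ g N n) (K := 0) h₁ h₂ ih (by rw [h, add_zero])
        (by rw [add_zero]; exact minCall_mono n (by omega))
        (by rw [add_zero]; exact minCall_mono n (by omega))
    · have hd : ∀ x, x ≤ g i → callDist R ε (n + 2) x (g i) =
          R (n + 2) (g i + ε) - R (n + 2) (x + ε) := fun x hx =>
        max_eq_left (by linarith [hdiff (n + 2) x (g i) hx])
      have hgi : g (j + 2) ≤ g i := hg.monotone (by omega)
      refine chord_of_le (f := fun x => R (n + 2) (x + ε))
        (K := minCall R ε S₀ g N n (g i) - R (n + 2) (g i + ε)) h₁ h₂ (hp _) ?_ ?_ ?_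
      · rw [h, hd _ (by linarith)]; linarith
      · have := hlow (g j); rw [hd _ (by linarith)] at this; linarith
      · have := hlow (g (j + 2)); rw [hd _ (by linarith)] at this; linarith

end MinimalCalls

/-! ### From call functions to laws close to a given one -/

section FiniteLaw

/-- The call function of the law with point masses `p x` at `x ∈ F`. -/
noncomputable def finCall (F : Finset ℝ) (p : ℝ → ℝ) (k : ℝ) : ℝ := ∑ x ∈ F, p x * max (x - k) 0

variable {F : Finset ℝ} {p : ℝ → ℝ} {ε : ℝ}

theorem finCall_chord (hp : ∀ x, 0 ≤ p x) {a y b : ℝ} (hay : a ≤ y) (hyb : y ≤ b) :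
    finCall F p y * (b - a) ≤ finCall F p a * (b - y) + finCall F p b * (y - a) := by
  unfold finCall
  rw [Finset.sum_mul, Finset.sum_mul, Finset.sum_mul, ← Finset.sum_add_distrib]
  refine Finset.sum_le_sum fun x _ => ?_
  have : max (x - y) 0 * (b - a) ≤ max (x - a) 0 * (b - y) + max (x - b) 0 * (y - a) := by
    have h₁ := le_max_left (x - a) 0
    have h₂ := le_max_left (x - b) 0
    have h₃ := le_max_right (x - a) 0
    have h₄ := le_max_right (x - b) 0
    rcases max_cases (x - y) 0 with ⟨h, -⟩ | ⟨h, -⟩ <;> rw [h] <;>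
    nlinarith [mul_le_mul_of_nonneg_right h₁ (sub_nonneg.2 hyb),
      mul_le_mul_of_nonneg_right h₂ (sub_nonneg.2 hay),
      mul_nonneg h₃ (sub_nonneg.2 hyb), mul_nonneg h₄ (sub_nonneg.2 hay)]
  have := mul_le_mul_of_nonneg_left this (hp x)
  linarith

theorem finCall_shift_sub_le (hp : ∀ x, 0 ≤ p x) (hε : 0 ≤ ε) {a b : ℝ} (hab : a ≤ b) :
    finCall F p (b - ε) - finCall F p (a - ε) ≤ finCall F p (b + ε) - finCall F p (a + ε) := by
  unfold finCall
  rw [← Finset.sum_sub_distrib, ← Finset.sum_sub_distrib]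
  refine Finset.sum_le_sum fun x _ => ?_
  have h := call_diff_antitone hab (show x - ε ≤ x + ε by linarith)
  have e₁ : ∀ c, x + ε - c = x - (c - ε) := fun c => by ring
  have e₂ : ∀ c, x - ε - c = x - (c + ε) := fun c => by ring
  rw [e₁, e₁, e₂, e₂] at h
  rw [← mul_sub, ← mul_sub]
  exact mul_le_mul_of_nonneg_left h (hp x)

theorem finCall_antitone (hp : ∀ x, 0 ≤ p x) : Antitone (finCall F p) := fun a b hab =>
  Finset.sum_le_sum fun x _ => mul_le_mul_of_nonneg_left
    (max_le_max_right 0 (by linarith)) (hp x)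

theorem finCall_nonneg (hp : ∀ x, 0 ≤ p x) (k : ℝ) : 0 ≤ finCall F p k :=
  Finset.sum_nonneg fun x _ => mul_nonneg (hp x) (le_max_right _ _)

theorem finCall_eq_zero {k : ℝ} (h : ∀ x ∈ F, x ≤ k) : finCall F p k = 0 :=
  Finset.sum_eq_zero fun x hx => by rw [max_eq_right (by linarith [h x hx]), mul_zero]

theorem finCall_eq_mean_sub (hp₁ : ∑ x ∈ F, p x = 1) {k : ℝ} (h : ∀ x ∈ F, p x ≠ 0 → k ≤ x) :
    finCall F p k = ∑ x ∈ F, p x * x - k := by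
  have : ∀ x ∈ F, p x * max (x - k) 0 = p x * x - p x * k := by
    intro x hx
    by_cases h0 : p x = 0
    · simp [h0]
    · rw [max_eq_left (by linarith [h x hx h0])]; ring
  rw [finCall, Finset.sum_congr rfl this, Finset.sum_sub_distrib, ← Finset.sum_mul, hp₁, one_mul]

theorem mean_sub_le_finCall (hp : ∀ x, 0 ≤ p x) (hp₁ : ∑ x ∈ F, p x = 1) (k : ℝ) :
    ∑ x ∈ F, p x * x - k ≤ finCall F p k := by
  have : ∑ x ∈ F, p x * x - k = ∑ x ∈ F, p x * (x - k) := by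
    simp only [mul_sub, Finset.sum_sub_distrib, ← Finset.sum_mul, hp₁, one_mul]
  rw [this]
  exact Finset.sum_le_sum fun x _ => mul_le_mul_of_nonneg_left (le_max_left _ _) (hp x)

theorem finCall_sub_le (hp : ∀ x, 0 ≤ p x) (hp₁ : ∑ x ∈ F, p x = 1) {a b : ℝ} (hab : a ≤ b) :
    finCall F p a ≤ finCall F p b + (b - a) := by
  have : finCall F p b + (b - a) = ∑ x ∈ F, p x * (max (x - b) 0 + (b - a)) := by
    simp only [mul_add, Finset.sum_add_distrib, ← Finset.sum_mul, hp₁, one_mul, finCall]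
  rw [this]
  refine Finset.sum_le_sum fun x _ => mul_le_mul_of_nonneg_left (max_le ?_ ?_) (hp x)
  · linarith [le_max_left (x - b) 0]
  · linarith [le_max_right (x - b) 0]

theorem finCall_sub_eq {a b : ℝ} (hab : a < b) (h : ∀ x ∈ F, x ≤ a ∨ b ≤ x) :
    finCall F p b - finCall F p a = (b - a) * (∑ x ∈ F with x ≤ a, p x - ∑ x ∈ F, p x) := by
  unfold finCall
  rw [Finset.sum_filter, ← Finset.sum_sub_distrib, ← Finset.sum_sub_distrib, Finset.mul_sum]
  refine Finset.sum_congr rfl fun x hx => ?_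
  rcases h x hx with h | h
  · rw [if_pos h, max_eq_right (by linarith), max_eq_right (by linarith)]; ring
  · rw [if_neg (by linarith), max_eq_left (by linarith), max_eq_left (by linarith)]; ring

variable {g c : ℕ → ℝ} {N : ℕ}

/-- A function `c` on a grid that is compatible with the law `p` is the call function of the second
marginal of a coupling with `p` that moves points by at most `ε`. -/
theorem exists_joint_law (hg : StrictMono g) (hp : ∀ x, 0 ≤ p x) (hp₁ : ∑ x ∈ F, p x = 1)
    (hadd : ∀ x ∈ F, ∃ i, g i = x + ε) (hsub : ∀ x ∈ F, ∃ i, g i = x - ε)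
    (hN : c N = 0) (hN' : c (N + 1) = 0) (h₀ : gridSlope g c 0 = -1)
    (hmono : ∀ j < N, gridSlope g c j ≤ gridSlope g c (j + 1))
    (hle : ∀ i ≤ N, c (i + 1) - c i ≤ finCall F p (g (i + 1) + ε) - finCall F p (g i + ε))
    (hge : ∀ i ≤ N, c i - c (i + 1) ≤ finCall F p (g i - ε) - finCall F p (g (i + 1) - ε)) :
    ∃ J : F → Fin N → ℝ, (∀ x j, 0 ≤ J x j) ∧ (∀ x, ∑ j, J x j = p x) ∧
      (∀ x j, J x j ≠ 0 → |(x : ℝ) - g (j + 1)| ≤ ε) ∧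
      ∀ i ≤ N, ∑ x, ∑ j, J x j * max (g (j + 1) - g i) 0 = c i := by
  set σ := gridSlope g c with hσ
  have hσN : σ N = 0 := by simp [hσ, gridSlope, hN, hN']
  have hpos : ∀ i, 0 < g (i + 1) - g i := fun i => sub_pos.2 (hg (Nat.lt_succ_self i))
  have hgap : ∀ i m, g m ≤ g i ∨ g (i + 1) ≤ g m := fun i m => by
    rcases Nat.lt_or_ge i m with h | h
    · exact .inr (hg.monotone h)
    · exact .inl (hg.monotone h)
  -- Slope plus one is a distribution function, so increment bounds become comparisons of shifted
  -- distribution functions. No atom of p lies strictly between g i + ε and g (i + 1) + ε because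
  -- the grid contains all x - ε.
  have hup : ∀ i ≤ N, σ i + 1 ≤ ∑ x ∈ F with x ≤ g i + ε, p x := by
    intro i hi
    have h₁ := hle i hi
    rw [finCall_sub_eq (by linarith [hpos i]) (fun x hx => ?_), hp₁,
      ← gridSlope_mul hg c i, ← hσ] at h₁
    · have h₂ := hpos i
      have : σ i * (g (i + 1) - g i) ≤ (∑ x ∈ F with x ≤ g i + ε, p x - 1) * (g (i + 1) - g i) := by
        linarith
      linarith [le_of_mul_le_mul_right this h₂]
    · obtain ⟨m, hm⟩ := hsub x hx
      rcases hgap i m with h | h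
      · left; linarith
      · right; linarith
  have hlow : ∀ i ≤ N, ∑ x ∈ F with x ≤ g i - ε, p x ≤ σ i + 1 := by
    intro i hi
    have h₁ := hge i hi
    have h₃ := finCall_sub_eq (F := F) (p := p) (a := g i - ε) (b := g (i + 1) - ε)
      (by linarith [hpos i]) (fun x hx => by
        obtain ⟨m, hm⟩ := hadd x hx
        rcases hgap i m with h | h
        · left; linarith
        · right; linarith)
    rw [hp₁] at h₃
    have h₄ := gridSlope_mul hg c i
    rw [← hσ] at h₄
    have : (∑ x ∈ F with x ≤ g i - ε, p x - 1) * (g (i + 1) - g i) ≤ σ i * (g (i + 1) - g i) := by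
      linarith
    linarith [le_of_mul_le_mul_right this (hpos i)]
  -- The mass with index j sits at g (j + 1), where the slope jumps from σ j to σ (j + 1).
  let q : Fin N → ℝ := fun j => σ (j + 1) - σ j
  have htel : ∀ m, ∑ j ∈ Finset.range m, (σ (j + 1) - σ j) = σ m + 1 := fun m => by
    rw [Finset.sum_range_sub, h₀]; ring
  have hq₁ : ∑ j, q j = 1 := by
    rw [Fin.sum_univ_eq_sum_range (fun j => σ (j + 1) - σ j), htel, hσN]; ring
  have hqfilter : ∀ (P : ℕ → Prop) [DecidablePred P] (m : ℕ), (∀ j, j < N ∧ P j ↔ j < m) →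
      ∑ j ∈ Finset.univ.filter (fun j : Fin N => P j), q j = σ m + 1 := by
    intro P _ m hm
    rw [Finset.sum_filter, Fin.sum_univ_eq_sum_range (fun j => if P j then σ (j + 1) - σ j else 0),
      ← Finset.sum_filter, ← htel m]
    refine Finset.sum_congr ?_ fun _ _ => rfl
    ext j
    simp [hm]
  have hsubtype : ∀ (P : ℝ → Prop) [DecidablePred P],
      ∑ x ∈ Finset.univ.filter (fun x : F => P x), p x = ∑ x ∈ F with P x, p x := by
    intro P _
    rw [Finset.sum_filter, Finset.sum_filter, ← Finset.sum_coe_sort F]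
  obtain ⟨J, hJ, hJ₁, hJ₂, hJ₃⟩ := exists_monotone_coupling (p := fun x : F => p x) (q := q)
    (fun x => hp x) (fun j => sub_nonneg.2 (hmono j j.2)) (by rw [Finset.sum_coe_sort F]; exact hp₁)
    hq₁
  refine ⟨J, hJ, hJ₁, fun x j hne => ?_, fun i hi => ?_⟩
  · obtain ⟨h₁, h₂⟩ := hJ₃ x j hne
    have e₁ : ∑ i with i ≤ j, q i = σ (j + 1) + 1 :=
      hqfilter (fun i => i ≤ (j : ℕ)) (j + 1) fun i => by omega
    have e₂ : ∑ i with i < j, q i = σ j + 1 :=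
      hqfilter (fun i => i < (j : ℕ)) j fun i => by omega
    have e₃ : ∑ y with y < x, p y = ∑ y ∈ F with y < (x : ℝ), p y := hsubtype (fun y => y < (x : ℝ))
    have e₄ : ∑ y with y ≤ x, p y = ∑ y ∈ F with y ≤ (x : ℝ), p y := hsubtype (fun y => y ≤ (x : ℝ))
    rw [e₁, e₃] at h₁
    rw [e₂, e₄] at h₂
    rw [abs_le]
    constructor
    · by_contra! hlt
      obtain ⟨m, hm⟩ := hadd x x.2
      -- As x + ε is a grid point below g (j + 1), it is at most g j. Thus `hlow` at j bounds the
      -- mass of p up to x by the mass of q strictly before j.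
      have hmj : m ≤ j := Nat.lt_succ_iff.1 (hg.lt_iff_lt.1 (by rw [hm]; linarith))
      have hxle : (x : ℝ) ≤ g j - ε := by linarith [hg.monotone hmj]
      have h₃ := hlow j j.2.le
      have h₄ : ∑ y ∈ F with y ≤ (x : ℝ), p y ≤ ∑ y ∈ F with y ≤ g j - ε, p y :=
        Finset.sum_le_sum_of_subset_of_nonneg (fun y hy => by
          rw [Finset.mem_filter] at hy ⊢
          exact ⟨hy.1, hy.2.trans hxle⟩) fun y _ _ => hp y
      linarith
    · by_contra! hlt
      have h₃ := hup (j + 1) j.2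
      have h₄ : ∑ y ∈ F with y ≤ g (j + 1) + ε, p y ≤ ∑ y ∈ F with y < (x : ℝ), p y :=
        Finset.sum_le_sum_of_subset_of_nonneg (fun y hy => by
          rw [Finset.mem_filter] at hy ⊢
          exact ⟨hy.1, by linarith [hy.2]⟩) fun y _ _ => hp y
      linarith
  · rw [Finset.sum_comm]
    simp only [← Finset.sum_mul, hJ₂]
    rw [Fin.sum_univ_eq_sum_range (fun j => (σ (j + 1) - σ j) * max (g (j + 1) - g i) 0)]
    exact sum_masses_call hg c hN hN' hi

end FiniteLaw

/-! ### Construction of the one-period joint laws -/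

/-- Finitely supported joint laws of reference price and price system, ordered in convex order. -/
theorem exists_joint_laws {T : ℕ} {ε S₀ : ℝ} {F : Finset ℝ} {p : ℕ → ℝ → ℝ} (hε : 0 ≤ ε)
    (hS : S₀ ∈ F) (hp : ∀ t x, 0 ≤ p t x) (hp₁ : ∀ t, ∑ x ∈ F, p t x = 1)
    (hpε : ∀ t, ∀ x ∈ F, p t x ≠ 0 → ε ≤ x)
    (hm : ∀ t, |∑ x ∈ F, p t x * x - S₀| ≤ ε)
    (hP : PathConditions T (fun t => finCall F (p t)) ε S₀) :
    ∃ (E : Type) (_ : Fintype E) (x z : E → ℝ) (w : ℕ → E → ℝ), (∀ t ≤ T, ∀ e, 0 ≤ w t e) ∧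
      (∀ t ≤ T, ∑ e, w t e = 1) ∧ (∀ e, w 0 e ≠ 0 → x e = S₀ ∧ z e = S₀) ∧
      (∀ t, 1 ≤ t → t ≤ T → ∀ k, ∑ e, w t e * max (x e - k) 0 = finCall F (p t) k) ∧
      (∀ t, 1 ≤ t → t ≤ T → ∀ e, w t e ≠ 0 → |x e - z e| ≤ ε ∧ x e ∈ F ∧ p t (x e) ≠ 0) ∧
      ∀ t, t + 1 ≤ T → ∀ φ : ℝ → ℝ, ConvexOn ℝ Set.univ φ →
        ∑ e, w t e * φ (z e) ≤ ∑ e, w (t + 1) e * φ (z e) := by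
  classical
  set R : ℕ → ℝ → ℝ := fun t => finCall F (p t) with hR
  have hchord : ∀ t a y b, a ≤ y → y ≤ b →
      R t y * (b - a) ≤ R t a * (b - y) + R t b * (y - a) :=
    fun t a y b h₁ h₂ => finCall_chord (hp t) h₁ h₂
  have hdiff : ∀ t a b, a ≤ b → R t (b - ε) - R t (a - ε) ≤ R t (b + ε) - R t (a + ε) :=
    fun t a b h => finCall_shift_sub_le (hp t) hε h
  have hRε : ∀ t, R t ε = ∑ x ∈ F, p t x * x - ε := fun t => finCall_eq_mean_sub (hp₁ t) (hpε t)
  have hb : ∀ t, 0 ≤ S₀ - R t ε ∧ S₀ - 2 * ε - R t ε ≤ 0 := fun t => by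
    have := abs_le.1 (hm t)
    rw [hRε]
    constructor <;> linarith
  have hanti : ∀ t x, R t (x + ε) ≤ R t (x - ε) :=
    fun t x => finCall_antitone (hp t) (by linarith)
  have hlip : ∀ t x, R t (x - ε) ≤ R t (x + ε) + 2 * ε := fun t x => by
    have := finCall_sub_le (hp t) (hp₁ t) (show x - ε ≤ x + ε by linarith)
    simp only [hR]; linarith
  have hRnn : ∀ t x, 0 ≤ R t x := fun t x => finCall_nonneg (hp t) x
  have hlu : ∀ x, lowerCall R ε S₀ x ≤ upperCall R ε S₀ 1 x := fun x => by
    refine max_le (le_min ?_ ?_) (le_min ?_ ?_) <;>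
    linarith [hanti 1 x, hlip 1 x, (hb 1).1, (hb 1).2]
  -- Placing b on the grid forces g 0 and g 1 below all atoms even after a shift by ε. There every
  -- R_s is mean minus strike.
  obtain ⟨b, hbF⟩ : ∃ b, ∀ x ∈ F, b < x - ε := by
    obtain ⟨b, hb⟩ := F.bddBelow
    exact ⟨b - 1 - ε, fun x hx => by linarith [hb hx]⟩
  obtain ⟨g, N, hg, hgs⟩ := exists_grid
    (insert b (insert S₀ (F.image (· + ε) ∪ F.image (· - ε))))
  have hadd : ∀ x ∈ F, ∃ i < N, g (i + 1) = x + ε := fun x hx => hgs _ (by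
    simp only [Finset.mem_insert, Finset.mem_union, Finset.mem_image]
    exact .inr (.inr (.inl ⟨x, hx, rfl⟩)))
  have hsub : ∀ x ∈ F, ∃ i < N, g (i + 1) = x - ε := fun x hx => hgs _ (by
    simp only [Finset.mem_insert, Finset.mem_union, Finset.mem_image]
    exact .inr (.inr (.inr ⟨x, hx, rfl⟩)))
  obtain ⟨i₀, hi₀, hgi₀⟩ := hgs S₀ (by simp)
  obtain ⟨ib, hib, hgib⟩ := hgs b (by simp)
  let c : ℕ → ℕ → ℝ := fun t i => minCall R ε S₀ g N (t - 1) (g i)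
  -- At the bottom of the grid the lower and upper bounds coincide, which fixes the initial slope -1
  -- and the mean S₀.
  have hbot : ∀ t, 1 ≤ t → t ≤ T → ∀ i ≤ 1, c t i = S₀ - g i := by
    intro t h1 hT i hi
    obtain ⟨n, rfl⟩ := Nat.exists_eq_add_of_le' h1
    have hgi : g i ≤ b := hgib ▸ hg.monotone (by omega)
    have key : ∀ s k, k ≤ g i + ε → R s k = R s ε + ε - k := fun s k hk => by
      rw [hRε]
      simp only [hR]
      rw [finCall_eq_mean_sub (hp₁ s) fun x hx _ => by linarith [hbF x hx]]
      ring
    have l₁ := lowerCall_le_minCall (R := R) (ε := ε) (S₀ := S₀) (g := g) (N := N) n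
      (show i ≤ N + 1 by omega)
    have l₂ := minCall_le_upperCall (g := g) (N := N) hP hlu hT (g i)
    have l₃ : R 1 (g i - ε) + (S₀ - 2 * ε - R 1 ε) ≤ lowerCall R ε S₀ (g i) := le_max_right _ _
    have l₄ : upperCall R ε S₀ (n + 1) (g i) ≤ R (n + 1) (g i + ε) + (S₀ - R (n + 1) ε) :=
      min_le_right _ _
    rw [key _ _ (by linarith)] at l₃
    rw [key _ _ le_rfl] at l₄
    simp only [c, Nat.add_sub_cancel]
    linarith
  have htop : ∀ t, 1 ≤ t → t ≤ T → ∀ i, N ≤ i → i ≤ N + 1 → c t i = 0 := by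
    intro t h1 hT i hi hi'
    obtain ⟨n, rfl⟩ := Nat.exists_eq_add_of_le' h1
    have l₁ := lowerCall_le_minCall (R := R) (ε := ε) (S₀ := S₀) (g := g) (N := N) n hi'
    have l₂ := minCall_le_upperCall (g := g) (N := N) hP hlu hT (g i)
    have l₃ : R 1 (g i + ε) ≤ lowerCall R ε S₀ (g i) := le_max_left _ _
    have l₄ : upperCall R ε S₀ (n + 1) (g i) ≤ R (n + 1) (g i - ε) := min_le_left _ _
    have l₅ : R (n + 1) (g i - ε) = 0 := finCall_eq_zero fun x hx => by
      obtain ⟨m, hm, hgm⟩ := hadd x hx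
      have : g (m + 1) ≤ g i := hg.monotone (by omega)
      linarith
    have l₆ := hRnn 1 (g i + ε)
    simp only [c, Nat.add_sub_cancel]
    linarith
  have hlaw : ∀ t, 1 ≤ t → t ≤ T → ∃ J : F → Fin N → ℝ, (∀ x j, 0 ≤ J x j) ∧
      (∀ x, ∑ j, J x j = p t x) ∧ (∀ x j, J x j ≠ 0 → |(x : ℝ) - g (j + 1)| ≤ ε) ∧
      ∀ i ≤ N, ∑ x, ∑ j, J x j * max (g (j + 1) - g i) 0 = c t i := by
    intro t h1 hT
    have hpos : ∀ i, 0 < g (i + 1) - g i := fun i => sub_pos.2 (hg (Nat.lt_succ_self i))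
    refine exists_joint_law hg (hp t) (hp₁ t) (fun x hx => (hadd x hx).imp' _ fun i h => h.2)
      (fun x hx => (hsub x hx).imp' _ fun i h => h.2) (htop t h1 hT N le_rfl (by omega))
      (htop t h1 hT (N + 1) (by omega) le_rfl) ?_ ?_ ?_ ?_
    · rw [gridSlope, hbot t h1 hT 0 (by omega), hbot t h1 hT (0 + 1) (by omega),
        div_eq_iff (hpos 0).ne']
      ring
    · intro j hj
      have h := minCall_chord (S₀ := S₀) hg hchord hdiff (t - 1) (show j + 1 ≤ N from hj)
      rw [gridSlope, gridSlope, div_le_div_iff₀ (hpos j) (hpos (j + 1))]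
      simp only [c]
      linarith
    · intro i hi
      have h := minCall_sub_le (R := R) (ε := ε) (S₀ := S₀) (g := g) (N := N) (t - 1) (g i)
        (g (i + 1))
      rw [Nat.sub_add_cancel h1, callDist,
        max_eq_left (hdiff t _ _ (hg.monotone (Nat.le_succ i)))] at h
      exact h
    · intro i hi
      have h := minCall_sub_le (R := R) (ε := ε) (S₀ := S₀) (g := g) (N := N) (t - 1) (g (i + 1))
        (g i)
      rw [Nat.sub_add_cancel h1, callDist,
        max_eq_right (by linarith [hdiff t _ _ (hg.monotone (Nat.le_succ i))])] at h
      exact h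
  choose! J hJ₀ hJ₁ hJ₂ hJ₃ using hlaw
  let e₀ : F × Fin N := (⟨S₀, hS⟩, ⟨i₀, hi₀⟩)
  let w : ℕ → F × Fin N → ℝ := fun t e => if t = 0 then (Pi.single e₀ 1 : F × Fin N → ℝ) e else J t e.1 e.2
  have hw : ∀ t, 1 ≤ t → ∀ e, w t e = J t e.1 e.2 := fun t ht e => if_neg (by omega)
  have hw₀ : ∀ e, w 0 e = (Pi.single e₀ 1 : F × Fin N → ℝ) e := fun e => if_pos rfl
  have hnn : ∀ t ≤ T, ∀ e, 0 ≤ w t e := by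
    intro t hT e
    rcases Nat.eq_zero_or_pos t with rfl | ht
    · rw [hw₀, Pi.single_apply]; split_ifs <;> norm_num
    · rw [hw t ht]; exact hJ₀ t ht hT _ _
  have hone : ∀ t ≤ T, ∑ e, w t e = 1 := by
    intro t hT
    rcases Nat.eq_zero_or_pos t with rfl | ht
    · simp [hw₀]
    · simp only [hw t ht, Fintype.sum_prod_type, hJ₁ t ht hT]
      rw [Finset.sum_coe_sort F (p t)]
      exact hp₁ t
  have hcall : ∀ t, 1 ≤ t → t ≤ T → ∀ i ≤ N,
      ∑ e, w t e * max (g (e.2 + 1) - g i) 0 = c t i := by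
    intro t ht hT i hi
    simp only [hw t ht, Fintype.sum_prod_type]
    exact hJ₃ t ht hT i hi
  have hcall₀ : ∀ i, ∑ e, w 0 e * max (g (e.2 + 1) - g i) 0 = max (S₀ - g i) 0 := by
    intro i
    simp only [hw₀, Pi.single_apply, ite_mul, one_mul, zero_mul, Finset.sum_ite_eq',
      Finset.mem_univ, if_true, e₀, hgi₀]
  have hmean : ∀ t ≤ T, ∑ e, w t e * g (e.2 + 1) = S₀ := by
    intro t hT
    have h : ∑ e, w t e * max (g (e.2 + 1) - g 0) 0 = S₀ - g 0 := by
      rcases Nat.eq_zero_or_pos t with rfl | ht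
      · rw [hcall₀, max_eq_left]
        rw [← hgi₀]
        exact sub_nonneg.2 (hg.monotone (Nat.zero_le _))
      · rw [hcall t ht hT 0 (Nat.zero_le _), hbot t ht hT 0 (by omega)]
    have e : ∀ e : F × Fin N, w t e * max (g (e.2 + 1) - g 0) 0 = w t e * g (e.2 + 1) - w t e * g 0 :=
      fun e => by rw [max_eq_left (sub_nonneg.2 (hg.monotone (Nat.zero_le _)))]; ring
    rw [Finset.sum_congr rfl fun a _ => e a, Finset.sum_sub_distrib, ← Finset.sum_mul, hone t hT] at h
    linarith
  refine ⟨F × Fin N, inferInstance, fun e => e.1, fun e => g (e.2 + 1), w, hnn, hone, ?_, ?_, ?_, ?_⟩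
  · intro e he
    rw [hw₀, Pi.single_apply] at he
    have : e = e₀ := by by_contra h; simp [h] at he
    subst this
    exact ⟨rfl, hgi₀⟩
  · intro t ht hT k
    simp only [hw t ht, Fintype.sum_prod_type, ← Finset.sum_mul, hJ₁ t ht hT]
    rw [finCall, ← Finset.sum_coe_sort F]
  · intro t ht hT e he
    rw [hw t ht] at he
    refine ⟨hJ₂ t ht hT _ _ he, e.1.2, fun h0 => he ?_⟩
    have := hJ₁ t ht hT e.1
    rw [h0] at this
    exact (Finset.sum_eq_zero_iff_of_nonneg fun j _ => hJ₀ t ht hT _ j).1 this e.2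
      (Finset.mem_univ _)
  · intro t hT φ hφ
    refine convex_order_of_calls (ia := fun e : F × Fin N => (e.2 : ℕ) + 1)
      (ib := fun e : F × Fin N => (e.2 : ℕ) + 1) (N := N) hg (hone t (by omega)) (hone _ hT)
      (fun e => e.2.2) (fun e => e.2.2) ?_ ?_ hφ
    · rw [hmean t (by omega), hmean _ hT]
    · intro i hi
      rw [hcall (t + 1) (by omega) hT i hi]
      -- The law at time 0 is a point mass, so the first step needs the Jensen bound (S₀ - k)⁺ ≤
      -- C_1(k), read off from `lowerCall`.
      rcases Nat.eq_zero_or_pos t with rfl | ht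
      · rw [hcall₀]
        have l₁ : R 1 (g i + ε) ≤ c 1 i := le_max_left _ _
        have l₂ : R 1 (g i - ε) + (S₀ - 2 * ε - R 1 ε) ≤ c 1 i := le_max_right _ _
        have l₃ : ∑ x ∈ F, p 1 x * x - (g i - ε) ≤ R 1 (g i - ε) :=
          mean_sub_le_finCall (hp 1) (hp₁ 1) _
        rw [hRε] at l₂
        exact max_le (by linarith) ((hRnn _ _).trans l₁)
      · rw [hcall t ht (by omega) i hi]
        obtain ⟨n, rfl⟩ := Nat.exists_eq_add_of_le' ht
        exact minCall_mono (R := R) (ε := ε) (S₀ := S₀) (g := g) n (by omega)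

/-! ### Path space and construction of the model -/

/-- Gluing martingale couplings to a path space. -/
theorem exists_martingale_paths {E : Type} [Fintype E] (z : E → ℝ) (w : ℕ → E → ℝ) (T : ℕ)
    (hw : ∀ t ≤ T, ∀ e, 0 ≤ w t e) (hw₁ : ∀ t ≤ T, ∑ e, w t e = 1)
    (hconv : ∀ t, t + 1 ≤ T → ∀ φ : ℝ → ℝ, ConvexOn ℝ Set.univ φ →
      ∑ e, w t e * φ (z e) ≤ ∑ e, w (t + 1) e * φ (z e)) :
    ∃ (Ω : Type) (_ : Fintype Ω) (P : Ω → ℝ) (X : ℕ → Ω → E), (∀ ω, 0 ≤ P ω) ∧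
      (∀ t ≤ T, ∀ f : E → ℝ, ∑ ω, P ω * f (X t ω) = ∑ e, w t e * f e) ∧
      ∀ i j, i ≤ j → j ≤ T → ∀ φ : Ω → ℝ,
        (∀ ω ω', (∀ k ≤ i, X k ω = X k ω') → φ ω = φ ω') →
          ∑ ω, P ω * φ ω * (z (X j ω) - z (X i ω)) = 0 := by
  classical
  induction T with
  | zero =>
    refine ⟨E, inferInstance, w 0, fun _ e => e, hw 0 le_rfl, fun t ht f => ?_, fun i j _ _ φ _ => ?_⟩
    · rw [Nat.le_zero.1 ht]
    · simp
  | succ n ih =>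
    obtain ⟨Ω, _, P, X, hP, hmarg, hmart⟩ := ih (fun t ht => hw t (by omega))
      (fun t ht => hw₁ t (by omega)) fun t ht => hconv t (by omega)
    have : Nonempty E := by
      by_contra h
      rw [not_nonempty_iff] at h
      simpa using hw₁ 0 (Nat.zero_le _)
    obtain ⟨J, hJ, hJ₁, hJ₂, hJ₃⟩ := exists_martingale_coupling z z (hw₁ n (by omega))
      (hw n (by omega)) (hw (n + 1) le_rfl) (hconv n le_rfl)
    have hJ0 : ∀ a b, w n a = 0 → J a b = 0 := fun a b h =>
      (Finset.sum_eq_zero_iff_of_nonneg fun b _ => hJ a b).1 (by rw [hJ₁, h]) b (Finset.mem_univ b)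
    have hP0 : ∀ ω, w n (X n ω) = 0 → P ω = 0 := by
      intro ω h
      have h' := hmarg n le_rfl fun e => if e = X n ω then 1 else 0
      simp only [mul_ite, mul_one, mul_zero, Finset.sum_ite_eq', Finset.mem_univ, if_true, h] at h'
      have := (Finset.sum_eq_zero_iff_of_nonneg fun ω' _ => by
        split_ifs
        exacts [hP ω', le_rfl]).1 h' ω (Finset.mem_univ ω)
      simpa using this
    -- The new coordinate is drawn from the conditional law of the coupling given the current state.
    -- Division by zero is harmless, since such paths have weight zero by `hP0`.
    let Q : Ω × E → ℝ := fun x => P x.1 * (J (X n x.1) x.2 / w n (X n x.1))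
    let Y : ℕ → Ω × E → E := fun t x => if t ≤ n then X t x.1 else x.2
    have hY : ∀ t ≤ n, ∀ x, Y t x = X t x.1 := fun t ht x => if_pos ht
    have hY' : ∀ x, Y (n + 1) x = x.2 := fun x => if_neg (by omega)
    have hQsum : ∀ ω, ∑ e, Q (ω, e) = P ω := by
      intro ω
      simp only [Q, ← Finset.mul_sum, ← Finset.sum_div, hJ₁]
      by_cases h : w n (X n ω) = 0
      · rw [hP0 ω h, zero_mul]
      · rw [div_self h, mul_one]
    have hQmart : ∀ ω, ∑ e, Q (ω, e) * (z e - z (X n ω)) = 0 := by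
      intro ω
      have : ∀ e, Q (ω, e) * (z e - z (X n ω)) =
          P ω / w n (X n ω) * (J (X n ω) e * (z e - z (X n ω))) := fun e => by
        simp only [Q]; ring
      rw [Finset.sum_congr rfl fun e _ => this e, ← Finset.mul_sum, hJ₃, mul_zero]
    refine ⟨Ω × E, inferInstance, Q, Y, fun x => mul_nonneg (hP _)
      (div_nonneg (hJ _ _) (hw n (by omega) _)), ?_, ?_⟩
    · intro t ht f
      rcases Nat.lt_or_ge n t with h | h
      · obtain rfl : t = n + 1 := by omega
        have h' := hmarg n le_rfl fun a => ∑ e, J a e / w n a * f e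
        simp only [hY', Fintype.sum_prod_type]
        have e₁ : ∀ ω, ∑ e, Q (ω, e) * f e =
            P ω * ∑ e, J (X n ω) e / w n (X n ω) * f e := fun ω => by
          rw [Finset.mul_sum]
          exact Finset.sum_congr rfl fun e _ => by simp only [Q]; ring
        have e₂ : ∀ a, w n a * ∑ e, J a e / w n a * f e = ∑ e, J a e * f e := fun a => by
          rw [Finset.mul_sum]
          refine Finset.sum_congr rfl fun e _ => ?_
          by_cases h : w n a = 0
          · rw [hJ0 a e h, h]; simp
          · field_simp
        rw [Finset.sum_congr rfl fun ω _ => e₁ ω, h', Finset.sum_congr rfl fun a _ => e₂ a,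
          Finset.sum_comm]
        exact Finset.sum_congr rfl fun e _ => by rw [← Finset.sum_mul, hJ₂]
      · simp only [hY t h, Fintype.sum_prod_type, ← Finset.sum_mul, hQsum]
        exact hmarg t h f
    · intro i j hij hj φ hφ
      rcases Nat.lt_or_ge n i with hi | hi
      · obtain rfl : i = j := by omega
        simp
      -- A test function of the history up to i ≤ n ignores the new coordinate; `X 0 ω` merely fills
      -- that slot.
      have hφ' : ∀ ω e, φ (ω, e) = φ (ω, X 0 ω) := fun ω e => hφ _ _ fun k hk => by
        rw [hY k (by omega), hY k (by omega)]
      have hinv : ∀ ω ω', (∀ k ≤ i, X k ω = X k ω') → φ (ω, X 0 ω) = φ (ω', X 0 ω') :=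
        fun ω ω' h => hφ _ _ fun k hk => by
          rw [hY k (by omega), hY k (by omega)]; exact h k hk
      rw [Fintype.sum_prod_type]
      rcases Nat.lt_or_ge n j with h | h
      · obtain rfl : j = n + 1 := by omega
        have e₁ : ∀ ω, ∑ e, Q (ω, e) * φ (ω, e) * (z (Y (n + 1) (ω, e)) - z (Y i (ω, e))) =
            P ω * φ (ω, X 0 ω) * (z (X n ω) - z (X i ω)) := by
          intro ω
          have e₂ : ∀ e, Q (ω, e) * φ (ω, e) * (z (Y (n + 1) (ω, e)) - z (Y i (ω, e))) =
              φ (ω, X 0 ω) * (Q (ω, e) * (z e - z (X n ω))) +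
                Q (ω, e) * (φ (ω, X 0 ω) * (z (X n ω) - z (X i ω))) := fun e => by
            rw [hφ' ω e, hY', hY i hi]; ring
          rw [Finset.sum_congr rfl fun e _ => e₂ e, Finset.sum_add_distrib, ← Finset.mul_sum,
            hQmart, ← Finset.sum_mul, hQsum]
          ring
        rw [Finset.sum_congr rfl fun ω _ => e₁ ω]
        exact hmart i n hi le_rfl _ hinv
      · have e₁ : ∀ ω, ∑ e, Q (ω, e) * φ (ω, e) * (z (Y j (ω, e)) - z (Y i (ω, e))) =
            P ω * φ (ω, X 0 ω) * (z (X j ω) - z (X i ω)) := by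
          intro ω
          simp only [hY j h, hY i hi, hφ' ω, ← Finset.sum_mul, hQsum]
        rw [Finset.sum_congr rfl fun ω _ => e₁ ω]
        exact hmart i j hij h _ hinv

theorem integral_eq_sum_of_compl_null {μ : Measure ℝ} [IsFiniteMeasure μ] {F : Finset ℝ}
    (h : μ ((F : Set ℝ)ᶜ) = 0) (f : ℝ → ℝ) : ∫ y, f y ∂μ = ∑ x ∈ F, μ.real {x} * f x := by
  have hr : μ.restrict (F : Set ℝ) = μ :=
    Measure.restrict_eq_self_of_ae_mem (by rw [ae_iff]; exact h)
  conv_lhs => rw [← hr]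
  rw [setIntegral_finset F IntegrableOn.finset]
  rfl

/-- Discounted laws with the properties below give a consistent model. -/
theorem exists_model {D : MarketData} {ε S₀ : ℝ} {R : ℕ → ℝ → ℝ} {μ : ℕ → Measure ℝ}
    (hε : 0 ≤ ε) (hS₀ : ε ≤ S₀) (hA : SimplifyingAssumptions D ε S₀ R μ) {E : Type} [Fintype E]
    {x z : E → ℝ} {w : ℕ → E → ℝ} (hw : ∀ t ≤ D.T, ∀ e, 0 ≤ w t e)
    (hw₁ : ∀ t ≤ D.T, ∑ e, w t e = 1) (hw₀ : ∀ e, w 0 e ≠ 0 → x e = S₀ ∧ z e = S₀)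
    (hR : ∀ t, 1 ≤ t → t ≤ D.T → ∀ k, ∑ e, w t e * max (x e - k) 0 = R t k)
    (hxz : ∀ t, 1 ≤ t → t ≤ D.T → ∀ e, w t e ≠ 0 → |x e - z e| ≤ ε ∧ ε ≤ x e)
    (hconv : ∀ t, t + 1 ≤ D.T → ∀ φ : ℝ → ℝ, ConvexOn ℝ Set.univ φ →
      ∑ e, w t e * φ (z e) ≤ ∑ e, w (t + 1) e * φ (z e)) :
    ∃ M : BidAskModel D.T, M.IsEpsConsistent D ε ∧
      ((∀ t, 1 ≤ t → t ≤ D.T → ∀ e, w t e ≠ 0 → x e ≠ ε) → M.Positive) := by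
  classical
  obtain ⟨Ω, _, P, X, hP, hmarg, hmart⟩ := exists_martingale_paths z w D.T hw hw₁ hconv
  let mΩ : MeasurableSpace Ω := ⊤
  have : MeasurableSingletonClass Ω := ⟨fun _ => trivial⟩
  have hP₁ : ∑ ω, P ω = 1 := by
    have := hmarg 0 (Nat.zero_le _) fun _ => 1
    simpa [hw₁ 0 (Nat.zero_le _)] using this
  let π : PMF Ω := PMF.ofFintype (fun ω => ENNReal.ofReal (P ω)) (by
    rw [← ENNReal.ofReal_sum_of_nonneg fun ω _ => hP ω, hP₁, ENNReal.ofReal_one])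
  have hint : ∀ f : Ω → ℝ, ∫ ω, f ω ∂π.toMeasure = ∑ ω, P ω * f ω := by
    intro f
    rw [PMF.integral_eq_sum]
    refine Finset.sum_congr rfl fun ω _ => ?_
    simp [π, ENNReal.toReal_ofReal (hP ω)]
  have hae : ∀ t ≤ D.T, ∀ p : E → Prop, (∀ e, w t e ≠ 0 → p e) → ∀ᵐ ω ∂π.toMeasure, p (X t ω) := by
    intro t ht p hp
    rw [ae_iff, PMF.toMeasure_apply_eq_zero_iff _ MeasurableSpace.measurableSet_top, Set.disjoint_left]
    intro ω hω hnp
    refine hnp (hp _ fun h0 => ?_)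
    have h' := hmarg t ht fun e => if e = X t ω then 1 else 0
    simp only [mul_ite, mul_one, mul_zero, Finset.sum_ite_eq', Finset.mem_univ, if_true, h0] at h'
    have := (Finset.sum_eq_zero_iff_of_nonneg fun ω' _ => by
      split_ifs
      exacts [hP ω', le_rfl]).1 h' ω (Finset.mem_univ ω)
    rw [if_pos rfl] at this
    rw [PMF.mem_support_iff] at hω
    exact hω (by simp [π, this])
  let hist : ∀ t : Fin (D.T + 1), Ω → (Set.Iic (t : ℕ) → E) := fun t ω k => X k ω
  let ℱ : Filtration (Fin (D.T + 1)) mΩ :=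
    { seq := fun t => MeasurableSpace.comap (hist t) ⊤
      mono' := by
        rintro i j hij _ ⟨s, -, rfl⟩
        exact ⟨(fun h (k : Set.Iic (i : ℕ)) => h ⟨k, le_trans k.2 (Fin.le_def.1 hij)⟩) ⁻¹' s,
          trivial, rfl⟩
      le' := fun _ _ _ => trivial }
  have hadapted : ∀ (t : Fin (D.T + 1)) (f : E → ℝ),
      StronglyMeasurable[ℱ t] fun ω => f (X t ω) := by
    intro t f
    refine Measurable.stronglyMeasurable fun s _ => ?_
    exact ⟨(fun h => f (h ⟨t, Set.mem_Iic.2 le_rfl⟩)) ⁻¹' s, trivial, rfl⟩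
  have hB : ∀ t : Fin (D.T + 1), 0 < D.B t := fun t => D.B_pos t (by omega)
  have hS₀pos : 0 < S₀ := hA.bid₀_eq ▸ D.bid₀_pos
  have hsupp : ∀ t ≤ D.T, ∀ e, w t e ≠ 0 → |x e - z e| ≤ ε ∧ ε ≤ x e := by
    intro t ht e he
    rcases Nat.eq_zero_or_pos t with rfl | h
    · obtain ⟨h₁, h₂⟩ := hw₀ e he
      rw [h₁, h₂]
      simpa using ⟨hε, hS₀⟩
    · exact hxz t h ht e he
  let M : BidAskModel D.T :=
    { Ω := Ω
      finite := inferInstance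
      mΩ := mΩ
      P := π.toMeasure
      isProb := inferInstance
      ℱ := ℱ
      bid := fun t ω => D.B t * min (x (X t ω)) (z (X t ω))
      ref := fun t ω => D.B t * x (X t ω)
      ask := fun t ω => D.B t * max (x (X t ω)) (z (X t ω))
      adapted_bid := fun t => hadapted t fun e => D.B t * min (x e) (z e)
      adapted_ref := fun t => hadapted t fun e => D.B t * x e
      adapted_ask := fun t => hadapted t fun e => D.B t * max (x e) (z e)
      bid_nonneg := fun t => by
        filter_upwards [hae t (by omega) _ (hsupp t (by omega))] with ω hω
        exact mul_nonneg (hB t).le (le_min (by linarith) (by linarith [(abs_le.1 hω.1).2]))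
      bid_le_ref := fun t => Filter.Eventually.of_forall fun ω =>
        mul_le_mul_of_nonneg_left (min_le_left _ _) (hB t).le
      ref_le_ask := fun t => Filter.Eventually.of_forall fun ω =>
        mul_le_mul_of_nonneg_left (le_max_left _ _) (hB t).le }
  refine ⟨M, ⟨⟨?_, ?_, ?_, ?_⟩, ?_, ?_⟩, ?_⟩
  · filter_upwards [hae 0 (Nat.zero_le _) _ hw₀] with ω hω
    have hω' : x (X 0 ω) = S₀ ∧ z (X 0 ω) = S₀ := hω
    simp [M, D.B_zero, hω'.1, hω'.2, hA.bid₀_eq]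
  · filter_upwards [hae 0 (Nat.zero_le _) _ hw₀] with ω hω
    have hω' : x (X 0 ω) = S₀ ∧ z (X 0 ω) = S₀ := hω
    simp [M, D.B_zero, hω'.1, hω'.2, hA.ask₀_eq]
  · intro t ht k _
    have e : ∫ ω, max ((D.B t)⁻¹ * M.ref t ω - k) 0 ∂M.P = R t k := by
      simp only [M, inv_mul_cancel_left₀ (hB t).ne']
      rw [hint, hmarg t (by omega) fun e => max (x e - k) 0, hR t ht (by omega)]
    rw [e, hA.optBid_eq t ht (by omega), hA.optAsk_eq t ht (by omega)]
    exact ⟨le_rfl, le_rfl⟩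
  · refine ⟨fun t ω => D.B t * z (X t ω), fun t => Filter.Eventually.of_forall fun ω =>
      ⟨mul_le_mul_of_nonneg_left (min_le_right _ _) (hB t).le,
        mul_le_mul_of_nonneg_left (le_max_right _ _) (hB t).le⟩, ?_⟩
    simp only [inv_mul_cancel_left₀ (hB _).ne']
    have hi : ∀ f : Ω → ℝ, Integrable f π.toMeasure := fun f => Integrable.of_finite
    refine ⟨fun t => hadapted t z, fun i j hij => ?_⟩
    refine (ae_eq_condExp_of_forall_setIntegral_eq (ℱ.le i) (hi _) (fun s _ _ => (hi _).integrableOn)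
      ?_ (hadapted i z).aestronglyMeasurable).symm
    rintro s ⟨s', -, rfl⟩ -
    have hs : MeasurableSet (hist i ⁻¹' s') := trivial
    rw [← integral_indicator hs, ← integral_indicator hs, hint, hint]
    -- Events of the generated filtration are preimages under the history map, so their indicators
    -- are admissible test functions.
    have h := hmart i j hij (by omega) ((hist i ⁻¹' s').indicator 1) fun ω ω' hω => by
      have : hist i ω = hist i ω' := funext fun k => hω k k.2
      simp only [Set.indicator_apply, Set.mem_preimage, this, Pi.one_apply]
    rw [eq_comm, ← sub_eq_zero, ← Finset.sum_sub_distrib, ← h]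
    refine Finset.sum_congr rfl fun ω _ => ?_
    by_cases hω : ω ∈ hist i ⁻¹' s' <;> simp [hω]
    ring
  · intro t
    filter_upwards [hae t (by omega) _ (hsupp t (by omega))] with ω hω
    simp only [M]
    rw [← mul_sub, mul_comm ε, max_sub_min_eq_abs']
    exact mul_le_mul_of_nonneg_left hω.1 (hB t).le
  · intro t
    filter_upwards [hae t (by omega) _ (hsupp t (by omega))] with ω hω
    simp only [M]
    rw [mul_comm ε]
    exact mul_le_mul_of_nonneg_left hω.2 (hB t).le
  · intro hne t
    have hpos : ∀ e, w t e ≠ 0 → 0 < min (x e) (z e) := by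
      intro e he
      rcases Nat.eq_zero_or_pos (t : ℕ) with h | h
      · obtain ⟨h₁, h₂⟩ := hw₀ e (h ▸ he)
        rw [h₁, h₂, min_self]
        exact hS₀pos
      · obtain ⟨h₁, h₂⟩ := hxz t h (by omega) e he
        have h₃ := lt_of_le_of_ne h₂ (hne t h (by omega) e he).symm
        -- Here z ≥ x - ε > 0. An atom of the reference law at ε would allow z = 0, whence the
        -- restriction for strict positivity.
        exact lt_min (by linarith) (by linarith [(abs_le.1 h₁).2])
    filter_upwards [hae t (by omega) _ hpos] with ω hω
    exact mul_pos (hB t) hω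

theorem pathConditions_congr {T : ℕ} {R R' : ℕ → ℝ → ℝ} {ε S₀ : ℝ}
    (h : ∀ t, 1 ≤ t → t ≤ T → R t = R' t) (hP : PathConditions T R ε S₀) :
    PathConditions T R' ε S₀ := by
  intro u hu huT k
  have e : ∀ s₁ sᵤ, pathSum R' ε k u s₁ sᵤ = pathSum R ε k u s₁ sᵤ := fun s₁ sᵤ => by
    refine Finset.sum_congr rfl fun t ht => ?_
    rw [Finset.mem_Icc] at ht
    rw [h t ht.1 (by omega), h (t + 1) (by omega) (by omega)]
  simpa only [e, h 1 le_rfl (by omega), h u (by omega) huT] using hP u hu huT k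

theorem exists_model_of_pathConditions {D : MarketData} {ε S₀ : ℝ} {R : ℕ → ℝ → ℝ}
    {μ : ℕ → Measure ℝ} (hε : 0 ≤ ε) (hS₀ : ε ≤ S₀) (hA : SimplifyingAssumptions D ε S₀ R μ)
    (hP : PathConditions D.T R ε S₀) : ∃ M : BidAskModel D.T, M.IsEpsConsistent D ε ∧
      ((∀ t, 1 ≤ t → t ≤ D.T → μ t {ε} = 0) → M.Positive) := by
  classical
  have hsupp := hA.finite_support
  choose! G hGε hG using hsupp
  -- Indices outside 1, …, T are sent to maturity 1, so that the laws are defined and well behaved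
  -- for every t.
  let τ : ℕ → ℕ := fun t => if 1 ≤ t ∧ t ≤ D.T then t else 1
  have hτ : ∀ t, 1 ≤ τ t ∧ τ t ≤ D.T := fun t => by
    have := D.one_le_T
    simp only [τ]
    split_ifs <;> omega
  have hτ' : ∀ t, 1 ≤ t → t ≤ D.T → τ t = t := fun t h1 hT => if_pos ⟨h1, hT⟩
  have hprob : ∀ t, IsProbabilityMeasure (μ (τ t)) := fun t => hA.isProb _ (hτ t).1 (hτ t).2
  let F : Finset ℝ := insert S₀ ((Finset.Icc 1 D.T).biUnion G)
  let p : ℕ → ℝ → ℝ := fun t x => (μ (τ t)).real {x}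
  have hGF : ∀ t, G (τ t) ⊆ F := fun t x hx => Finset.mem_insert_of_mem
    (Finset.mem_biUnion.2 ⟨τ t, Finset.mem_Icc.2 (hτ t), hx⟩)
  have hF : ∀ t, μ (τ t) ((F : Set ℝ)ᶜ) = 0 := fun t =>
    measure_mono_null (Set.compl_subset_compl.2 (Finset.coe_subset.2 (hGF t)))
      (hG _ (hτ t).1 (hτ t).2)
  have hint : ∀ t (f : ℝ → ℝ), ∫ y, f y ∂μ (τ t) = ∑ x ∈ F, p t x * f x := fun t f =>
    integral_eq_sum_of_compl_null (hF t) f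
  have hR : ∀ t, 1 ≤ t → t ≤ D.T → R t = finCall F (p t) := fun t h1 hT => by
    ext k
    rw [hA.R_eq t h1 hT, finCall, ← hint, hτ' t h1 hT]
    rfl
  have hpG : ∀ t x, p t x ≠ 0 → x ∈ G (τ t) := fun t x hx => by
    by_contra h
    refine hx ?_
    simp only [p, measureReal_def]
    rw [measure_mono_null (Set.singleton_subset_iff.2 h) (hG _ (hτ t).1 (hτ t).2)]
    rfl
  have hpε : ∀ t, ∀ x ∈ F, p t x ≠ 0 → ε ≤ x := fun t x _ hx =>
    hGε _ (hτ t).1 (hτ t).2 x (hpG t x hx)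
  obtain ⟨E, _, x, z, w, hw, hw₁, hw₀, hcall, hxz, hconv⟩ := exists_joint_laws (T := D.T) (F := F)
    (p := p) hε (Finset.mem_insert_self _ _) (fun _ _ => measureReal_nonneg)
    (fun t => by simpa using (hint t fun _ => 1).symm) hpε
    (fun t => by
      have := hA.mean_mem (τ t) (hτ t).1 (hτ t).2
      rw [hint t fun y => y] at this
      rw [abs_le]
      constructor <;> linarith [this.1, this.2])
    (pathConditions_congr hR hP)
  obtain ⟨M, hM, hpos⟩ := exists_model hε hS₀ hA hw hw₁ hw₀
    (fun t h1 hT k => by rw [hcall t h1 hT, hR t h1 hT])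
    (fun t h1 hT e he => ⟨(hxz t h1 hT e he).1, hpε t _ (hxz t h1 hT e he).2.1
      (hxz t h1 hT e he).2.2⟩) hconv
  refine ⟨M, hM, fun hμ => hpos fun t h1 hT e he hxe => (hxz t h1 hT e he).2.2 ?_⟩
  simp only [p, measureReal_def]
  rw [hxe, hτ' t h1 hT, hμ t h1 hT]
  rfl

/-- Under the simplifying assumptions, the four families of inequalities are necessary and
sufficient for the existence of `ε`-consistent models. The condition `ε ≤ S₀` is the lower bound on
the reference price at time `0`. If no `μ t` charges the point `ε`, the models can be taken with
strictly positive bid prices; in general, bid prices must be allowed to vanish. -/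
theorem mainTheorem2 (D : MarketData) (ε S₀ : ℝ) (R : ℕ → ℝ → ℝ) (μ : ℕ → Measure ℝ)
    (hε : 0 ≤ ε) (hS₀ : ε ≤ S₀) (hA : SimplifyingAssumptions D ε S₀ R μ) :
    (EpsConsistent D ε → PathConditions D.T R ε S₀) ∧
    ((∀ t, 1 ≤ t → t ≤ D.T → μ t {ε} = 0) →
      (EpsConsistent D ε ↔ PathConditions D.T R ε S₀)) ∧
    (EpsConsistentNonneg D ε ↔ PathConditions D.T R ε S₀) := by
  have hnec : EpsConsistent D ε → PathConditions D.T R ε S₀ := fun ⟨M, _, hM⟩ =>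
    pathConditions_of_epsConsistentNonneg hA ⟨M, hM⟩
  refine ⟨hnec, fun hμ => ⟨hnec, fun hP => ?_⟩,
    pathConditions_of_epsConsistentNonneg hA, fun hP => ?_⟩
  · obtain ⟨M, hM, hpos⟩ := exists_model_of_pathConditions hε hS₀ hA hP
    exact ⟨M, hpos hμ, hM⟩
  · obtain ⟨M, hM, _⟩ := exists_model_of_pathConditions hε hS₀ hA hP
    exact ⟨M, hM⟩
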